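/- Let $\Omega\subset\mathbb R^3$ be a bounded polyhedral domain resolved by a conforming macro-triangulation $\mathcal T_H$ into tetrahedra $T$ (each with an arbitrary fixed vertex ordering), i.e. $\Omega$ is the interior of the union of the closed macro-elements. Let $\mathcal T_h$ be obtained from $\mathcal T_H$ by $\ell\ge 0$ uniform refinement steps by Bey's rule (each ordered tetrahedron $(x_0,x_1,x_2,x_3)$ is cut into four corner tetrahedra and four tetrahedra sharing the diagonal joining the midpoints of $x_0x_2$ and $x_1x_3$, with Bey's vertex numbering of the children). Let $V_h$ be the space of continuous functions on $\overline\Omega$ that are affine on each $t\in\mathcal T_h$, with nodes $x_i$ and nodal basis $(\phi_i)$, and let $V_{h,0}\subset V_h$ be the functions vanishing on $\partial\Omega$. Let $k$ and $u$ be affine functions on $\mathbb R^3$ with $k\ge k_0>0$ on $\Omega$, and let $f\in L^2(\Omega)$ be such that $-\operatorname{div}(k\nabla u)=f$ weakly in $\Omega$; the Dirichlet data are the boundary values of $u$. For $v,w\in V_h$ with nodal values $\nu_i=v(x_i)$ and $\chi_i=w(x_i)$ put $$a_h(v,w)=\tfrac14\sum_{T\in\mathcal T_H}\sum_{i,j}\bigl(k(x_i)+k(x_j)\bigr)(\nu_i-\nu_j)(\chi_j-\chi_i)\int_T\nabla\phi_i\cdot\nabla\phi_j\,dx,$$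 $$\tilde a_h(v,w)=\sum_{t\in\mathcal T_h}\bar k_t\int_t\nabla v\cdot\nabla w\,dx,$$ where $\bar k_t$ is the mean of $k$ over the four vertices of $t$. Let $\mathcal W_V,\mathcal W_E,\mathcal W_F$ be the sets of nodes that are macro-vertices, that lie in the relative interior of a macro-edge, and that lie in the relative interior of a macro-face, respectively, and let $\mathcal W=\mathcal W_V\cup\mathcal W_E\cup\mathcal W_F$. For a set $\mathcal I$ of nodes let $a_{h;\mathcal I}$ be the form, linear in its second argument, with $$a_{h;\mathcal I}(v,\phi_i)=\tilde a_h(v,\phi_i)\ \text{ if } i\in\mathcal I,\qquad a_{h;\mathcal I}(v,\phi_i)=a_h(v,\phi_i)\ \text{ if } i\notin\mathcal I .$$ A finite element solution is a function $u_h\in V_h$ with $u_h=u$ on $\partial\Omega$ and $$a_{h;\mathcal I}(u_h,w)=\int_\Omega f\,w\,dx\qquad\text{for all } w\in V_{h,0}.$$ Let $\mathcal I=\mathcal W$ or $\mathcal I=\mathcal W_V\cup\mathcal W_E$. Then $u_h=u|_{\overline\Omega}$ is a finite element solution. If $\mathcal I=\mathcal W$, or if $a_{h;\mathcal I}$ is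 non-degenerate on $V_{h,0}$ (the only $v\in V_{h,0}$ with $a_{h;\mathcal I}(v,w)=0$ for all $w\in V_{h,0}$ is $v=0$; coercivity of $a_{h;\mathcal I}$ on $V_{h,0}$ suffices), then it is the only one: every finite element solution $u_h$ satisfies $u_h=u$ on $\overline\Omega$. -/

import Mathlib

open MeasureTheory
open scoped ContDiff

noncomputable section

namespace StencilScaling

/-- Physical space `ℝ³` with the Euclidean norm. -/
abbrev E3 := EuclideanSpace ℝ (Fin 3)

/-- A tetrahedron with an ordering of its four vertices. -/
abbrev Tet := Fin 4 → E3

/-- The closed tetrahedron as a point set. -/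
def Tet.body (t : Tet) : Set E3 := convexHull ℝ (Set.range t)

/-- The relatively open subsimplex of `t` spanned by the vertices with index in `s`. -/
def Tet.openFace (t : Tet) (s : Finset (Fin 4)) : Set E3 :=
  {x | ∃ c : Fin 4 → ℝ, (∀ m ∈ s, 0 < c m) ∧ (∀ m ∉ s, c m = 0) ∧
    ∑ m, c m = 1 ∧ ∑ m, c m • t m = x}

/-- Midpoint of the edge joining the vertices `i` and `j`. -/
def Tet.mid (t : Tet) (i j : Fin 4) : E3 := midpoint ℝ (t i) (t j)

/-- Bey's regular refinement of an ordered tetrahedron into eight ordered tetrahedra: four at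
the corners, and four obtained by cutting the inner octahedron along the diagonal that joins
the midpoints of the edges `02` and `13`. -/
def Tet.children (t : Tet) : Fin 8 → Tet :=
  ![![t 0, t.mid 0 1, t.mid 0 2, t.mid 0 3],
    ![t.mid 0 1, t 1, t.mid 1 2, t.mid 1 3],
    ![t.mid 0 2, t.mid 1 2, t 2, t.mid 2 3],
    ![t.mid 0 3, t.mid 1 3, t.mid 2 3, t 3],
    ![t.mid 0 1, t.mid 0 2, t.mid 0 3, t.mid 1 3],
    ![t.mid 0 1, t.mid 0 2, t.mid 1 2, t.mid 1 3],
    ![t.mid 0 2, t.mid 0 3, t.mid 1 3, t.mid 2 3],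
    ![t.mid 0 2, t.mid 1 2, t.mid 1 3, t.mid 2 3]]

open Classical in
/-- The tetrahedra obtained from `t` by `ℓ` steps of uniform refinement. -/
def Tet.refine (t : Tet) : ℕ → Finset Tet
  | 0 => {t}
  | ℓ + 1 => (t.refine ℓ).biUnion fun s => Finset.univ.image s.children

/-- A (possibly unstructured) conforming simplicial macro-triangulation in `ℝ³`. Each element
carries an arbitrary ordering of its vertices, which is used by the refinement rule. -/
structure MacroTriangulation where
  elems : Finset Tet
  nondegenerate : ∀ T ∈ elems, AffineIndependent ℝ T
  conforming : ∀ S ∈ elems, ∀ T ∈ elems,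
    S.body ∩ T.body = convexHull ℝ (Set.range S ∩ Set.range T)
  /-- no element is listed twice with different vertex orderings -/
  distinct : ∀ S ∈ elems, ∀ T ∈ elems, Set.range S = Set.range T → S = T

namespace MacroTriangulation

variable (M : MacroTriangulation)

/-- The closed polyhedron that is triangulated; it is the closure of `M.domain`. -/
def region : Set E3 := ⋃ T ∈ M.elems, T.body

/-- The polyhedral domain `Ω` resolved by the macro-triangulation. -/
def domain : Set E3 := interior M.region

open Classical in
/-- The refined triangulation `𝒯_h`, `h = 2^{-ℓ} H`. -/
def mesh (ℓ : ℕ) : Finset Tet := M.elems.biUnion fun T => T.refine ℓ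

open Classical in
/-- The mesh nodes: all vertices of the refined triangulation. -/
def nodes (ℓ : ℕ) : Finset E3 := (M.mesh ℓ).biUnion fun t => Finset.univ.image t

/-- The mesh nodes in the relatively open subsimplices with `n` vertices of macro-elements. -/
def primitiveNodes (ℓ n : ℕ) : Set E3 :=
  {x | x ∈ M.nodes ℓ ∧ ∃ T ∈ M.elems, ∃ s : Finset (Fin 4), s.card = n ∧ x ∈ T.openFace s}

/-- `𝒲_V`: nodes associated with the vertex primitives. -/
def vertexNodes (ℓ : ℕ) : Set E3 := M.primitiveNodes ℓ 1

/-- `𝒲_E`: nodes associated with the edge primitives. -/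
def edgeNodes (ℓ : ℕ) : Set E3 := M.primitiveNodes ℓ 2

/-- `𝒲_F`: nodes associated with the face primitives. -/
def faceNodes (ℓ : ℕ) : Set E3 := M.primitiveNodes ℓ 3

/-- `V_h`: continuous piecewise affine functions on the closed polyhedron. They are represented
as functions on `ℝ³` with value `0` outside the closed polyhedron. -/
def femSpace (ℓ : ℕ) : Submodule ℝ (E3 → ℝ) where
  carrier := {v | ContinuousOn v M.region ∧
    (∀ t ∈ M.mesh ℓ, ∃ a : E3 →ᵃ[ℝ] ℝ, Set.EqOn v a t.body) ∧ ∀ x ∉ M.region, v x = 0}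
  zero_mem' := ⟨continuousOn_const, fun _ _ => ⟨0, fun _ _ => rfl⟩, fun _ _ => rfl⟩
  add_mem' := by
    rintro v w ⟨hv, hva, hv0⟩ ⟨hw, hwa, hw0⟩
    refine ⟨hv.add hw, fun t ht => ?_, fun x hx => by simp [hv0 x hx, hw0 x hx]⟩
    obtain ⟨a, ha⟩ := hva t ht
    obtain ⟨b, hb⟩ := hwa t ht
    exact ⟨a + b, fun x hx => by simp [ha hx, hb hx]⟩
  smul_mem' := by
    rintro r v ⟨hv, hva, hv0⟩
    refine ⟨hv.const_smul r, fun t ht => ?_, fun x hx => by simp [hv0 x hx]⟩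
    obtain ⟨a, ha⟩ := hva t ht
    exact ⟨r • a, fun x hx => by simp [ha hx]⟩

/-- `V_h ∩ V_0`: the functions of `V_h` that vanish on `∂Ω`. -/
def femSpace₀ (ℓ : ℕ) : Submodule ℝ (E3 → ℝ) where
  carrier := {v | v ∈ M.femSpace ℓ ∧ ∀ x ∈ frontier M.domain, v x = 0}
  zero_mem' := ⟨Submodule.zero_mem _, fun _ _ => rfl⟩
  add_mem' := by
    rintro v w ⟨hv, hv0⟩ ⟨hw, hw0⟩
    exact ⟨Submodule.add_mem _ hv hw, fun x hx => by simp [hv0 x hx, hw0 x hx]⟩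
  smul_mem' := by
    rintro r v ⟨hv, hv0⟩
    exact ⟨Submodule.smul_mem _ r hv, fun x hx => by simp [hv0 x hx]⟩

/-- The nodal basis function `φ_i` of the node `i`: on each mesh tetrahedron having `i` as a
vertex it is the barycentric coordinate belonging to `i`, and it vanishes elsewhere. (For `x`
in the patch of `i` all tetrahedra of the patch that contain `x` give the same value, so the
supremum is over a singleton; outside the patch the set is empty and the supremum is `0`.) -/
def hat (ℓ : ℕ) (i : E3) (x : E3) : ℝ :=
  sSup {r | ∃ t ∈ M.mesh ℓ, ∃ m : Fin 4, t m = i ∧ ∃ c : Fin 4 → ℝ,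
    (∀ n, 0 ≤ c n) ∧ ∑ n, c n = 1 ∧ ∑ n, c n • t n = x ∧ c m = r}

/-- The stiffness entry `∫_T ∇φ_i · ∇φ_j dx` of the Laplacian on the macro-element `T`. -/
def stiffness (ℓ : ℕ) (T : Tet) (i j : E3) : ℝ :=
  ∫ x in T.body, inner ℝ (gradient (M.hat ℓ i) x) (gradient (M.hat ℓ j) x)

/-- The stencil-scaled form
`a_h(v,w) = ¼ ∑_T ∑_{i,j} (k(x_i) + k(x_j)) (ν_i - ν_j) (χ_j - χ_i) ∫_T ∇φ_i · ∇φ_j dx`,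
where `ν`, `χ` are the nodal values of `v`, `w`. -/
def scaledForm (ℓ : ℕ) (k v w : E3 → ℝ) : ℝ :=
  1 / 4 * ∑ T ∈ M.elems, ∑ i ∈ M.nodes ℓ, ∑ j ∈ M.nodes ℓ,
    (k i + k j) * (v i - v j) * (w j - w i) * M.stiffness ℓ T i j

/-- The standard finite element form with nodal quadrature of the coefficient,
`ã_h(v,w) = ∑_t k̄_t ∫_t ∇v · ∇w dx`, with `k̄_t` the mean of `k` over the vertices of `t`. -/
def nodalForm (ℓ : ℕ) (k v w : E3 → ℝ) : ℝ :=
  ∑ t ∈ M.mesh ℓ, (∑ m, k (t m)) / 4 * ∫ x in t.body, inner ℝ (gradient v x) (gradient w x)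

open Classical in
/-- The mixed form `a_{h;I}`: `a_{h;I}(v,φ_i)` is `ã_h(v,φ_i)` for `i ∈ I` and `a_h(v,φ_i)` for
`i ∉ I`, extended linearly in the second argument `w = ∑_i w(x_i) φ_i`. -/
def mixedForm (ℓ : ℕ) (I : Set E3) (k v w : E3 → ℝ) : ℝ :=
  ∑ i ∈ M.nodes ℓ, w i *
    (if i ∈ I then M.nodalForm ℓ k v (M.hat ℓ i) else M.scaledForm ℓ k v (M.hat ℓ i))

/-- `uh` is a finite element solution for the form `a_{h;I}`, the right-hand side `f` and the
Dirichlet data `g` on `∂Ω`. -/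
def IsDiscreteSolution (ℓ : ℕ) (I : Set E3) (k f g uh : E3 → ℝ) : Prop :=
  uh ∈ M.femSpace ℓ ∧ (∀ x ∈ frontier M.domain, uh x = g x) ∧
    ∀ w ∈ M.femSpace₀ ℓ, M.mixedForm ℓ I k uh w = ∫ x in M.domain, f x * w x

/-- The form `a_{h;I}` is non-degenerate on `V_h ∩ V_0`, i.e. the discrete problem has at most
one solution. Coercivity of the form on `V_h ∩ V_0` is sufficient for this. -/
def IsNondegenerate (ℓ : ℕ) (I : Set E3) (k : E3 → ℝ) : Prop :=
  ∀ v ∈ M.femSpace₀ ℓ, (∀ w ∈ M.femSpace₀ ℓ, M.mixedForm ℓ I k v w = 0) → v = 0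

end MacroTriangulation

/-- The function `u` solves `-div (k ∇u) = f` weakly in the open set `Ω`. (Test functions are
smooth with compact support in `Ω`, which are dense in `H¹₀(Ω)`. The Dirichlet data of the
problem are the boundary values of `u`.) -/
def IsWeakSolution (Ω : Set E3) (k f u : E3 → ℝ) : Prop :=
  ∀ ψ : E3 → ℝ, ContDiff ℝ ∞ ψ → HasCompactSupport ψ → tsupport ψ ⊆ Ω →
    ∫ x in Ω, k x * inner ℝ (gradient u x) (gradient ψ x) = ∫ x in Ω, f x * ψ x

end StencilScaling

end

/-!
Two facts carry the result: Bey's refinement of an ordered tetrahedron is an affine image of the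
Kuhn triangulation of a lattice, and this triangulation is invariant under point reflection at
every lattice point and at the midpoint of every edge.

*Refinement.* In the coordinates `y` of `kuhnPoint`, a macro-element is the simplex
`N ≥ y 0 ≥ y 1 ≥ y 2 ≥ 0` with `N = 2 ^ ℓ`, and its refinement consists of exactly those Kuhn
tetrahedra (base lattice point plus a path of unit steps in some order) that lie in this simplex
(`mem_refine`). Hence the mesh covers the polyhedron, its tetrahedra have no common interior
points, its nodes are the points with barycentric coordinates in `2⁻ˡ ℤ`, and the refinements of
two macro-elements fit together on a common face.

*Comparison of rows.* By `scaledForm_sub_nodalForm`, the values of the two forms at `(v, φ_i)` differ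
by the sum, over the edges of the tetrahedra at the node `i`, of `edgeDefect`: the mean of `k` over
the edge minus the mean over the tetrahedron, times the increment of `v`, times the element
stiffness entry. Reflection at the midpoint of an edge permutes the tetrahedra that share the edge
and changes the sign of this quantity when `k` is affine, so for a node in the interior of a
macro-element everything cancels, for every `v` (`sum_edgeDefect_interior`). For a node inside a
macro-face, each macro-element contributes half of a full lattice patch, and reflection at the node
exchanges the two halves. If `v` is affine too, this reflection preserves `edgeDefect`, so each half
contributes half of zero (`sum_edgeDefect_face`). Thus `a_{h;I}(u, φ_i)` equals the nodal form for
all `i`, and `a_{h;I}` is the nodal form if `I` contains all vertex, edge and face nodes.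

*Consistency of the nodal form.* The vertex mean of an affine function on a tetrahedron is its
integral mean, so the nodal form of `u` and `w` is `∫ k ∇u · ∇w`. A function `w` of `V_{h,0}`,
extended by zero, is Lipschitz, and integration by parts turns this into `-∇k · ∇u ∫ w`. The same
computation with smooth test functions gives `f = -∇k · ∇u` almost everywhere in `Ω`.

*Uniqueness.* The nodal form is definite on `V_{h,0}`: if it vanishes at `(v, v)`, then all gradients
of `v` vanish, so that `v` has Lipschitz constant `0` on `ℝ³` and vanishes far away.
-/

noncomputable section

namespace StencilScaling

/-! ### Tetrahedra and affine functions -/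

theorem Tet.mem_body {t : Tet} {x : E3} :
    x ∈ t.body ↔ ∃ c : Fin 4 → ℝ, (∀ n, 0 ≤ c n) ∧ ∑ n, c n = 1 ∧ ∑ n, c n • t n = x := by
  unfold Tet.body
  rw [convexHull_range_eq_exists_affineCombination]
  constructor
  · rintro ⟨s, w, h0, h1, rfl⟩
    refine ⟨fun n => if n ∈ s then w n else 0, fun n => ?_, ?_, ?_⟩
    · dsimp only
      split_ifs with h
      · exact h0 n h
      · exact le_rfl
    · rw [Finset.sum_ite_mem, Finset.univ_inter, h1]
    · rw [Finset.affineCombination_eq_linear_combination _ _ _ h1]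
      simp only [ite_smul, zero_smul]
      rw [Finset.sum_ite_mem, Finset.univ_inter]
  · rintro ⟨c, h0, h1, rfl⟩
    exact ⟨Finset.univ, c, fun n _ => h0 n, h1,
      Finset.affineCombination_eq_linear_combination _ _ _ h1⟩

theorem Tet.vertex_mem_body (t : Tet) (m : Fin 4) : t m ∈ t.body :=
  subset_convexHull ℝ _ ⟨m, rfl⟩

theorem Tet.convex_body (t : Tet) : Convex ℝ t.body := convex_convexHull ℝ _

theorem Tet.isCompact_body (t : Tet) : IsCompact t.body :=
  (Set.finite_range t).isCompact_convexHull ℝ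

theorem Tet.isClosed_body (t : Tet) : IsClosed t.body := t.isCompact_body.isClosed

theorem Tet.measurableSet_body (t : Tet) : MeasurableSet t.body := t.isClosed_body.measurableSet

theorem Tet.volume_body_ne_top (t : Tet) : volume t.body ≠ ⊤ := t.isCompact_body.measure_lt_top.ne

theorem Tet.interior_ae_eq_body (t : Tet) : interior t.body =ᵐ[volume] t.body :=
  interior_ae_eq_of_null_frontier (t.convex_body.addHaar_frontier volume)

/-- The vertices of a nondegenerate tetrahedron as an affine basis of `ℝ³`. -/
def Tet.basis (t : Tet) (h : AffineIndependent ℝ t) : AffineBasis (Fin 4) ℝ E3 where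
  toFun := t
  ind' := h
  tot' := by
    rw [h.affineSpan_eq_top_iff_card_eq_finrank_add_one]
    simp

open Classical in
/-- The barycentric coordinate of the vertex `m` as an affine function on `ℝ³`; it is `0` for a
degenerate tetrahedron. -/
def Tet.bary (t : Tet) (m : Fin 4) : E3 →ᵃ[ℝ] ℝ :=
  if h : AffineIndependent ℝ t then (t.basis h).coord m else 0

theorem Tet.bary_eq {t : Tet} (h : AffineIndependent ℝ t) (m : Fin 4) :
    t.bary m = (t.basis h).coord m := dif_pos h

theorem Tet.bary_vertex {t : Tet} (h : AffineIndependent ℝ t) (m n : Fin 4) :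
    t.bary m (t n) = if m = n then 1 else 0 := by
  rw [Tet.bary_eq h]
  exact (t.basis h).coord_apply m n

theorem Tet.sum_bary {t : Tet} (h : AffineIndependent ℝ t) (x : E3) : ∑ m, t.bary m x = 1 := by
  simp only [Tet.bary_eq h]
  exact (t.basis h).sum_coord_apply_eq_one x

theorem Tet.sum_bary_smul {t : Tet} (h : AffineIndependent ℝ t) (x : E3) :
    ∑ m, t.bary m x • t m = x := by
  simp only [Tet.bary_eq h]
  exact (t.basis h).linear_combination_coord_eq_self x

/-- An affine function commutes with affine combinations. -/
theorem affine_sum (a : E3 →ᵃ[ℝ] ℝ) {c : Fin 4 → ℝ} (hc : ∑ n, c n = 1) (p : Fin 4 → E3) :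
    a (∑ n, c n • p n) = ∑ n, c n * a (p n) := by
  rw [← Finset.affineCombination_eq_linear_combination _ _ _ hc,
    Finset.map_affineCombination _ _ _ hc, Finset.affineCombination_eq_linear_combination _ _ _ hc]
  rfl

theorem Tet.bary_sum {t : Tet} (h : AffineIndependent ℝ t) {c : Fin 4 → ℝ} (hc : ∑ n, c n = 1)
    (m : Fin 4) : t.bary m (∑ n, c n • t n) = c m := by
  rw [affine_sum _ hc]
  simp [Tet.bary_vertex h]

theorem Tet.affine_apply {t : Tet} (h : AffineIndependent ℝ t) (a : E3 →ᵃ[ℝ] ℝ) (x : E3) :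
    a x = ∑ m, a (t m) * t.bary m x := by
  conv_lhs => rw [← Tet.sum_bary_smul h x, affine_sum _ (Tet.sum_bary h x)]
  exact Finset.sum_congr rfl fun m _ => mul_comm _ _

theorem Tet.affine_eq_sum {t : Tet} (h : AffineIndependent ℝ t) (a : E3 →ᵃ[ℝ] ℝ) :
    a = ∑ m, a (t m) • t.bary m := by
  ext x
  rw [Tet.affine_apply h a x]
  simp [Fin.sum_univ_four]

theorem Tet.body_eq {t : Tet} (h : AffineIndependent ℝ t) :
    t.body = {x | ∀ m, 0 ≤ t.bary m x} := by
  simp only [Tet.bary_eq h]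
  exact (t.basis h).convexHull_eq_nonneg_coord

theorem Tet.interior_body {t : Tet} (h : AffineIndependent ℝ t) :
    interior t.body = {x | ∀ m, 0 < t.bary m x} := by
  simp only [Tet.bary_eq h]
  exact (t.basis h).interior_convexHull

theorem Tet.interior_body_nonempty {t : Tet} (h : AffineIndependent ℝ t) :
    (interior t.body).Nonempty := by
  have h1 : ∑ _n : Fin 4, (1 / 4 : ℝ) = 1 := by norm_num [Fin.sum_univ_four]
  refine ⟨∑ n, (1 / 4 : ℝ) • t n, ?_⟩
  rw [Tet.interior_body h]
  intro m
  rw [Tet.bary_sum h h1]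
  norm_num

theorem Tet.volume_body_pos {t : Tet} (h : AffineIndependent ℝ t) : 0 < volume.real t.body := by
  rw [measureReal_def, ENNReal.toReal_pos_iff]
  exact ⟨lt_of_lt_of_le (isOpen_interior.measure_pos volume (Tet.interior_body_nonempty h))
    (measure_mono interior_subset), t.volume_body_ne_top.lt_top⟩

/-- The (constant) gradient of an affine function. -/
def affineGrad (a : E3 →ᵃ[ℝ] ℝ) : E3 :=
  (InnerProductSpace.toDual ℝ E3).symm (LinearMap.toContinuousLinearMap a.linear)

theorem inner_affineGrad (a : E3 →ᵃ[ℝ] ℝ) (v : E3) : inner ℝ (affineGrad a) v = a.linear v := by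
  simp [affineGrad]

theorem affine_sub (a : E3 →ᵃ[ℝ] ℝ) (x y : E3) : a x - a y = inner ℝ (affineGrad a) (x - y) := by
  rw [inner_affineGrad]
  exact (a.linearMap_vsub x y).symm

theorem hasFDerivAt_affine (a : E3 →ᵃ[ℝ] ℝ) (x : E3) :
    HasFDerivAt a (LinearMap.toContinuousLinearMap a.linear) x := by
  have h : (a : E3 → ℝ) = fun y => LinearMap.toContinuousLinearMap a.linear y + a 0 := by
    ext y
    have := a.linearMap_vsub y 0
    simp at this ⊢
    linarith
  rw [h]
  exact (ContinuousLinearMap.hasFDerivAt _).add_const _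

theorem hasGradientAt_affine (a : E3 →ᵃ[ℝ] ℝ) (x : E3) : HasGradientAt a (affineGrad a) x := by
  rw [hasGradientAt_iff_hasFDerivAt]
  simpa [affineGrad] using hasFDerivAt_affine a x

theorem gradient_affine (a : E3 →ᵃ[ℝ] ℝ) (x : E3) : gradient a x = affineGrad a :=
  (hasGradientAt_affine a x).gradient

theorem continuous_affine (a : E3 →ᵃ[ℝ] ℝ) : Continuous a := a.continuous_of_finiteDimensional

theorem affineGrad_add (a b : E3 →ᵃ[ℝ] ℝ) : affineGrad (a + b) = affineGrad a + affineGrad b := by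
  simp [affineGrad]

theorem affineGrad_smul (r : ℝ) (a : E3 →ᵃ[ℝ] ℝ) : affineGrad (r • a) = r • affineGrad a := by
  simp [affineGrad]

theorem affineGrad_zero : affineGrad 0 = 0 := by
  simp [affineGrad]

theorem affineGrad_sum {ι : Type*} (s : Finset ι) (a : ι → E3 →ᵃ[ℝ] ℝ) :
    affineGrad (∑ i ∈ s, a i) = ∑ i ∈ s, affineGrad (a i) := by
  classical
  induction s using Finset.induction_on with
  | empty => simp [affineGrad_zero]
  | insert i s hi ih => rw [Finset.sum_insert hi, Finset.sum_insert hi, affineGrad_add, ih]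

theorem Tet.affineGrad_eq_sum {t : Tet} (h : AffineIndependent ℝ t) (a : E3 →ᵃ[ℝ] ℝ) :
    affineGrad a = ∑ m, a (t m) • affineGrad (t.bary m) := by
  conv_lhs => rw [Tet.affine_eq_sum h a, affineGrad_sum]
  simp only [affineGrad_smul]

theorem Tet.sum_affineGrad_bary {t : Tet} (h : AffineIndependent ℝ t) :
    ∑ m, affineGrad (t.bary m) = 0 := by
  have := Tet.affineGrad_eq_sum h (AffineMap.const ℝ E3 1)
  have h0 : affineGrad (AffineMap.const ℝ E3 (1 : ℝ)) = 0 := by simp [affineGrad]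
  rw [h0] at this
  simpa using this.symm

theorem gradient_eq_of_eqOn_interior {s : Set E3} {v : E3 → ℝ} {a : E3 →ᵃ[ℝ] ℝ}
    (hv : Set.EqOn v a (interior s)) {x : E3} (hx : x ∈ interior s) : gradient v x = affineGrad a := by
  have : v =ᶠ[nhds x] a := Filter.eventuallyEq_of_mem (isOpen_interior.mem_nhds hx) hv
  rw [this.gradient_eq, gradient_affine]

theorem Tet.setIntegral_interior (t : Tet) (F : E3 → ℝ) :
    ∫ x in t.body, F x = ∫ x in interior t.body, F x :=
  (setIntegral_congr_set t.interior_ae_eq_body).symm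

theorem Tet.integral_inner_gradient {t : Tet} {v w : E3 → ℝ} {a b : E3 →ᵃ[ℝ] ℝ}
    (hv : Set.EqOn v a (interior t.body)) (hw : Set.EqOn w b (interior t.body)) :
    ∫ x in t.body, inner ℝ (gradient v x) (gradient w x)
      = volume.real t.body * inner ℝ (affineGrad a) (affineGrad b) := by
  rw [t.setIntegral_interior, setIntegral_congr_fun (g := fun _ => inner ℝ (affineGrad a) (affineGrad b))
    isOpen_interior.measurableSet, ← t.setIntegral_interior]
  · simp
  · intro x hx
    simp only
    rw [gradient_eq_of_eqOn_interior hv hx, gradient_eq_of_eqOn_interior hw hx]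

/-- The element stiffness entry `∫_t ∇λ_m · ∇λ_n dx`. -/
def Tet.stiff (t : Tet) (m n : Fin 4) : ℝ :=
  volume.real t.body * inner ℝ (affineGrad (t.bary m)) (affineGrad (t.bary n))

theorem Tet.stiff_comm (t : Tet) (m n : Fin 4) : t.stiff m n = t.stiff n m := by
  rw [Tet.stiff, Tet.stiff, real_inner_comm]

theorem Tet.affineIndependent_reflect {t t' : Tet} (h : AffineIndependent ℝ t) {c : E3}
    (hc : ∀ l, t' l.rev = c - t l) : AffineIndependent ℝ t' := by
  have h1 : t' = ((AffineEquiv.constVSub ℝ c).toAffineMap ∘ t) ∘ Fin.revPerm := by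
    ext1 l
    have := hc l.rev
    rw [Fin.rev_rev] at this
    simp [this]
  rw [h1]
  refine AffineIndependent.comp_embedding Fin.revPerm.toEmbedding ?_
  exact h.map' _ (AffineEquiv.constVSub ℝ c).injective

theorem Tet.bary_reflect {t t' : Tet} (h : AffineIndependent ℝ t) {c : E3}
    (hc : ∀ l, t' l.rev = c - t l) (m : Fin 4) (x : E3) :
    t'.bary m.rev x = t.bary m (c - x) := by
  have h' := Tet.affineIndependent_reflect h hc
  have hs := Tet.sum_bary h (c - x)
  have hx : x = ∑ l : Fin 4, t.bary l.rev (c - x) • t' l := by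
    rw [← Equiv.sum_comp Fin.revPerm]
    simp only [Fin.revPerm_apply, Fin.rev_rev, hc, smul_sub, Finset.sum_sub_distrib,
      Tet.sum_bary_smul h, ← Finset.sum_smul, hs]
    simp
  have hs' : ∑ l : Fin 4, t.bary l.rev (c - x) = 1 := by
    rw [← hs, ← Equiv.sum_comp Fin.revPerm (fun l => t.bary l (c - x))]
    rfl
  conv_lhs => rw [hx]
  rw [Tet.bary_sum h' hs', Fin.rev_rev]

theorem Tet.affineGrad_bary_reflect {t t' : Tet} (h : AffineIndependent ℝ t) {c : E3}
    (hc : ∀ l, t' l.rev = c - t l) (m : Fin 4) :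
    affineGrad (t'.bary m.rev) = - affineGrad (t.bary m) := by
  refine ext_inner_right ℝ fun v => ?_
  have h1 := affine_sub (t'.bary m.rev) v 0
  rw [Tet.bary_reflect h hc, Tet.bary_reflect h hc, affine_sub] at h1
  rw [inner_neg_left]
  simp at h1
  linarith

theorem Tet.volume_reflect {t t' : Tet} (h : AffineIndependent ℝ t) {c : E3}
    (hc : ∀ l, t' l.rev = c - t l) : volume.real t'.body = volume.real t.body := by
  have h' := Tet.affineIndependent_reflect h hc
  have h1 : t'.body = (fun x => c - x) ⁻¹' t.body := by
    rw [Tet.body_eq h, Tet.body_eq h']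
    ext x
    simp only [Set.mem_ofPred_eq, Set.mem_preimage, ← Tet.bary_reflect h hc]
    exact ⟨fun H m => H _, fun H m => by simpa using H m.rev⟩
  rw [measureReal_def, measureReal_def, h1,
    (Measure.measurePreserving_sub_left volume c).measure_preimage t.measurableSet_body.nullMeasurableSet]

/-- The element stiffness matrix is invariant under point reflection. -/
theorem Tet.stiff_reflect {t t' : Tet} (h : AffineIndependent ℝ t) {c : E3}
    (hc : ∀ l, t' l.rev = c - t l) (m n : Fin 4) : t'.stiff m.rev n.rev = t.stiff m n := by
  rw [Tet.stiff, Tet.stiff, Tet.affineGrad_bary_reflect h hc, Tet.affineGrad_bary_reflect h hc,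
    Tet.volume_reflect h hc, inner_neg_neg]

/-- The affine involution that exchanges the vertices `m` and `n` preserves volume and the
tetrahedron, so all barycentric coordinates have the same integral. -/
theorem Tet.integral_bary_eq {t : Tet} (h : AffineIndependent ℝ t) (m n : Fin 4) :
    ∫ x in t.body, t.bary m x = ∫ x in t.body, t.bary n x := by
  rcases eq_or_ne m n with rfl | hmn
  · rfl
  -- The involution is `A x = x + (λ_m x - λ_n x) • d`; its linear part is `L`.
  set d : E3 := t n - t m with hd
  set δ : E3 →ₗ[ℝ] ℝ := (t.bary m).linear - (t.bary n).linear with hδ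
  have hlin : ∀ l, (t.bary l).linear d = (if l = n then 1 else 0) - if l = m then 1 else 0 := by
    intro l
    rw [hd, ← vsub_eq_sub, AffineMap.linearMap_vsub, Tet.bary_vertex h, Tet.bary_vertex h]
    rfl
  have hδd : δ d = -2 := by
    simp only [hδ, LinearMap.sub_apply, hlin]
    rw [if_neg hmn, if_neg hmn.symm]
    norm_num
  set L : E3 →ₗ[ℝ] E3 := LinearMap.id + δ.smulRight d with hL
  have hLL : L ∘ₗ L = LinearMap.id := by
    ext1 v
    simp only [hL, LinearMap.comp_apply, LinearMap.add_apply, LinearMap.id_apply,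
      LinearMap.smulRight_apply, map_add, map_smul, hδd]
    module
  -- An involution has determinant `1` or `-1`, so `A` preserves the volume.
  have hdet : |LinearMap.det L| = 1 := by
    have := congrArg LinearMap.det hLL
    rw [LinearMap.det_comp, LinearMap.det_id, ← pow_two] at this
    rw [← sq_abs] at this
    nlinarith [abs_nonneg (LinearMap.det L)]
  have hdet0 : LinearMap.det L ≠ 0 := by
    intro h0
    rw [h0] at hdet
    simp at hdet
  set e : E3 := (t.bary m 0 - t.bary n 0) • d with he
  set A : E3 → E3 := fun x => L x + e with hA
  have hLc : Continuous L := L.continuous_of_finiteDimensional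
  have hmp : MeasurePreserving A volume volume := by
    have h1 : MeasurePreserving L volume volume := by
      refine ⟨hLc.measurable, ?_⟩
      rw [Measure.map_linearMap_addHaar_eq_smul_addHaar _ hdet0, abs_inv, hdet]
      simp
    exact (measurePreserving_add_right volume e).comp h1
  have hsplit : ∀ l x, t.bary l x = (t.bary l).linear x + t.bary l 0 := by
    intro l x
    have := (t.bary l).linearMap_vsub x 0
    simp at this ⊢
    linarith
  have hAx : ∀ x, A x = x + (t.bary m x - t.bary n x) • d := by
    intro x
    simp only [hA, hL, he, hδ, LinearMap.add_apply, LinearMap.id_apply, LinearMap.smulRight_apply,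
      LinearMap.sub_apply]
    rw [hsplit m x, hsplit n x]
    module
  have hb : ∀ l x, t.bary l (A x) = t.bary l x + (t.bary m x - t.bary n x) *
      ((if l = n then 1 else 0) - if l = m then 1 else 0) := by
    intro l x
    have := (t.bary l).linearMap_vsub (A x) x
    rw [hAx] at this
    simp only [vsub_eq_sub, add_sub_cancel_left, map_smul, hlin, smul_eq_mul] at this
    rw [hAx]
    linarith
  -- `A` exchanges the barycentric coordinates `m` and `n` and fixes the others.
  have hbm : ∀ x, t.bary m (A x) = t.bary n x := by
    intro x
    rw [hb, if_neg hmn, if_pos rfl]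
    ring
  have hbn : ∀ x, t.bary n (A x) = t.bary m x := by
    intro x
    rw [hb, if_pos rfl, if_neg hmn.symm]
    ring
  have hbl : ∀ l x, l ≠ m → l ≠ n → t.bary l (A x) = t.bary l x := by
    intro l x h1 h2
    rw [hb, if_neg h2, if_neg h1]
    ring
  have hpre : A ⁻¹' t.body = t.body := by
    rw [Tet.body_eq h]
    ext x
    simp only [Set.mem_preimage, Set.mem_ofPred_eq]
    constructor
    · intro H l
      by_cases h1 : l = m
      · rw [h1, ← hbn]; exact H n
      by_cases h2 : l = n
      · rw [h2, ← hbm]; exact H m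
      rw [← hbl l x h1 h2]; exact H l
    · intro H l
      by_cases h1 : l = m
      · rw [h1, hbm]; exact H n
      by_cases h2 : l = n
      · rw [h2, hbn]; exact H m
      rw [hbl l x h1 h2]; exact H l
  have hcont := continuous_affine (t.bary m)
  conv_lhs => rw [← hmp.map_eq]
  rw [setIntegral_map t.measurableSet_body hcont.aestronglyMeasurable hmp.measurable.aemeasurable,
    hpre]
  simp only [hbm]

theorem Tet.integrableOn_of_continuous (t : Tet) {F : E3 → ℝ} (hF : Continuous F) :
    IntegrableOn F t.body :=
  hF.continuousOn.integrableOn_compact t.isCompact_body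

theorem Tet.integral_bary {t : Tet} (h : AffineIndependent ℝ t) (m : Fin 4) :
    ∫ x in t.body, t.bary m x = volume.real t.body / 4 := by
  have h1 : ∫ x in t.body, ∑ n, t.bary n x = volume.real t.body := by
    simp [Tet.sum_bary h]
  rw [integral_finsetSum _
    fun n _ => t.integrableOn_of_continuous (continuous_affine (t.bary n))] at h1
  rw [Finset.sum_congr rfl fun n _ => Tet.integral_bary_eq h n m] at h1
  simp at h1
  linarith

/-- The vertex mean is exact for the integral of an affine function. -/
theorem Tet.integral_affine {t : Tet} (h : AffineIndependent ℝ t) (a : E3 →ᵃ[ℝ] ℝ) :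
    ∫ x in t.body, a x = (∑ m, a (t m)) / 4 * volume.real t.body := by
  rw [integral_congr_ae (Filter.Eventually.of_forall (Tet.affine_apply h a)),
    integral_finsetSum _ fun n _ => (t.integrableOn_of_continuous
      (continuous_affine (t.bary n))).const_mul _]
  simp only [integral_const_mul, Tet.integral_bary h, ← Finset.sum_mul]
  ring

/-! ### Kuhn coordinates -/

/-- Barycentric weights of the point with Kuhn coordinates `y` in the simplex
`N ≥ y 0 ≥ y 1 ≥ y 2 ≥ 0`. -/
def kuhnWeight (N : ℝ) (y : Fin 3 → ℝ) : Fin 4 → ℝ :=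
  ![1 - y 0 / N, (y 0 - y 1) / N, (y 1 - y 2) / N, y 2 / N]

/-- The point with Kuhn coordinates `y` at scale `N`: starting from `T 0`, it is reached by the
multiples `y j / N` of the consecutive edge vectors `T (j + 1) - T j`. -/
def kuhnPoint (T : Tet) (N : ℝ) (y : Fin 3 → ℝ) : E3 := ∑ m, kuhnWeight N y m • T m

theorem sum_kuhnWeight (N : ℝ) (y : Fin 3 → ℝ) : ∑ m, kuhnWeight N y m = 1 := by
  simp [kuhnWeight, Fin.sum_univ_four]
  ring

/-- Lattice offset of the `m`-th vertex of a Kuhn tetrahedron, whose edge path takes a step in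
direction `j` at position `σ j`. -/
def pathOffset (σ : Equiv.Perm (Fin 3)) (m : Fin 4) (j : Fin 3) : ℤ :=
  if (σ j : ℕ) < (m : ℕ) then 1 else 0

/-- The Kuhn tetrahedron with base lattice point `p` whose edge path takes a step in direction `j`
at position `σ j`. -/
def kuhn (T : Tet) (N : ℕ) (p : Fin 3 → ℤ) (σ : Equiv.Perm (Fin 3)) : Tet := fun m =>
  kuhnPoint T N fun j => ((p j + pathOffset σ m j : ℤ) : ℝ)

theorem bary_kuhnPoint {T : Tet} (h : AffineIndependent ℝ T) (N : ℝ) (y : Fin 3 → ℝ) (m : Fin 4) :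
    T.bary m (kuhnPoint T N y) = kuhnWeight N y m :=
  Tet.bary_sum h (sum_kuhnWeight N y) m

theorem kuhnPoint_injective {T : Tet} (h : AffineIndependent ℝ T) {N : ℝ} (hN : N ≠ 0) :
    Function.Injective (kuhnPoint T N) := by
  intro y y' e
  have hm : ∀ m, kuhnWeight N y m = kuhnWeight N y' m := fun m => by
    rw [← bary_kuhnPoint h, ← bary_kuhnPoint h, e]
  have h1 := hm 1
  have h2 := hm 2
  have h3 := hm 3
  simp [kuhnWeight] at h1 h2 h3
  field_simp at h1 h2 h3
  ext j
  fin_cases j <;> simp <;> linarith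

theorem sum_smul_kuhnPoint (T : Tet) (N : ℝ) {c : Fin 4 → ℝ} (hc : ∑ n, c n = 1)
    (y : Fin 4 → Fin 3 → ℝ) :
    ∑ n, c n • kuhnPoint T N (y n) = kuhnPoint T N fun j => ∑ n, c n * y n j := by
  simp only [kuhnPoint, Finset.smul_sum, smul_smul]
  rw [Finset.sum_comm]
  refine Finset.sum_congr rfl fun m _ => ?_
  rw [← Finset.sum_smul]
  congr 1
  have h0 : c 0 = 1 - c 1 - c 2 - c 3 := by
    rw [Fin.sum_univ_four] at hc
    linarith
  fin_cases m <;> simp [kuhnWeight, Fin.sum_univ_four, h0] <;> ring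

theorem midpoint_kuhnPoint (T : Tet) (N : ℝ) (y y' : Fin 3 → ℝ) :
    midpoint ℝ (kuhnPoint T N y) (kuhnPoint T N y') = kuhnPoint T (2 * N) (y + y') := by
  simp only [midpoint_eq_smul_add, kuhnPoint, Fin.sum_univ_four, kuhnWeight, Pi.add_apply,
    Matrix.cons_val, div_eq_mul_inv, mul_inv, invOf_eq_inv]
  match_scalars <;> ring

theorem kuhnPoint_bary {T : Tet} (h : AffineIndependent ℝ T) {N : ℝ} (hN : N ≠ 0) {x : E3}
    {y : Fin 3 → ℝ} (h0 : y 0 = N * (T.bary 1 x + T.bary 2 x + T.bary 3 x))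
    (h1 : y 1 = N * (T.bary 2 x + T.bary 3 x)) (h2 : y 2 = N * T.bary 3 x) :
    kuhnPoint T N y = x := by
  have hs := Tet.sum_bary h x
  rw [Fin.sum_univ_four] at hs
  have hw : ∀ m, kuhnWeight N y m = T.bary m x := by
    intro m
    fin_cases m <;> simp [kuhnWeight, h0, h1, h2] <;> field_simp <;> linarith
  rw [kuhnPoint]
  simp only [hw]
  exact Tet.sum_bary_smul h x

/-- The weights of the vertices behind position `r` of an edge path. -/
def tailSum (c : Fin 4 → ℝ) : Fin 3 → ℝ := ![c 1 + c 2 + c 3, c 2 + c 3, c 3]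

theorem sum_mul_pathOffset (c : Fin 4 → ℝ) (σ : Equiv.Perm (Fin 3)) (j : Fin 3) :
    ∑ m, c m * (pathOffset σ m j : ℝ) = tailSum c (σ j) := by
  simp only [pathOffset, Fin.sum_univ_four]
  generalize σ j = r
  fin_cases r <;> simp [tailSum]

theorem sum_smul_kuhn (T : Tet) (N : ℕ) (p : Fin 3 → ℤ) (σ : Equiv.Perm (Fin 3)) {c : Fin 4 → ℝ}
    (hc : ∑ n, c n = 1) :
    ∑ n, c n • kuhn T N p σ n = kuhnPoint T N fun j => p j + tailSum c (σ j) := by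
  simp only [kuhn]
  rw [sum_smul_kuhnPoint T N hc]
  congr 1
  ext j
  push_cast
  simp only [mul_add, Finset.sum_add_distrib, sum_mul_pathOffset, ← Finset.sum_mul, hc, one_mul]

theorem affineIndependent_kuhn {T : Tet} (h : AffineIndependent ℝ T) {N : ℕ} (hN : N ≠ 0)
    (p : Fin 3 → ℤ) (σ : Equiv.Perm (Fin 3)) : AffineIndependent ℝ (kuhn T N p σ) := by
  rw [affineIndependent_iff_eq_of_fintype_affineCombination_eq]
  intro w w' hw hw' e
  rw [Finset.affineCombination_eq_linear_combination _ _ _ hw,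
    Finset.affineCombination_eq_linear_combination _ _ _ hw', sum_smul_kuhn _ _ _ _ hw,
    sum_smul_kuhn _ _ _ _ hw'] at e
  have e1 := kuhnPoint_injective h (Nat.cast_ne_zero.mpr hN) e
  have e2 : ∀ r, tailSum w r = tailSum w' r := by
    intro r
    have := congrFun e1 (σ.symm r)
    simpa using this
  have a0 := e2 0
  have a1 := e2 1
  have a2 := e2 2
  simp [tailSum] at a0 a1 a2
  rw [Fin.sum_univ_four] at hw hw'
  ext m
  fin_cases m <;> simp <;> linarith

theorem tailSum_nonneg {c : Fin 4 → ℝ} (hc : ∀ n, 0 ≤ c n) (r : Fin 3) : 0 ≤ tailSum c r := by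
  have := hc 1
  have := hc 2
  have := hc 3
  fin_cases r <;> simp [tailSum] <;> linarith

theorem tailSum_le_one {c : Fin 4 → ℝ} (hc : ∀ n, 0 ≤ c n) (h1 : ∑ n, c n = 1) (r : Fin 3) :
    tailSum c r ≤ 1 := by
  rw [Fin.sum_univ_four] at h1
  have := hc 0
  have := hc 1
  have := hc 2
  have := hc 3
  fin_cases r <;> simp [tailSum] <;> linarith

theorem tailSum_anti {c : Fin 4 → ℝ} (hc : ∀ n, 0 ≤ c n) {r s : Fin 3} (h : r ≤ s) :
    tailSum c s ≤ tailSum c r := by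
  have := hc 1
  have := hc 2
  have := hc 3
  fin_cases r <;> fin_cases s <;> simp [tailSum] at h ⊢ <;> linarith

theorem tailSum_pos {c : Fin 4 → ℝ} (hc : ∀ n, 0 < c n) (r : Fin 3) : 0 < tailSum c r := by
  have := hc 1
  have := hc 2
  have := hc 3
  fin_cases r <;> simp [tailSum] <;> linarith

theorem tailSum_lt_one {c : Fin 4 → ℝ} (hc : ∀ n, 0 < c n) (h1 : ∑ n, c n = 1) (r : Fin 3) :
    tailSum c r < 1 := by
  rw [Fin.sum_univ_four] at h1
  have := hc 0
  have := hc 1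
  have := hc 2
  have := hc 3
  fin_cases r <;> simp [tailSum] <;> linarith

theorem tailSum_strictAnti {c : Fin 4 → ℝ} (hc : ∀ n, 0 < c n) {r s : Fin 3} (h : r < s) :
    tailSum c s < tailSum c r := by
  have := hc 1
  have := hc 2
  have := hc 3
  fin_cases r <;> fin_cases s <;> simp [tailSum] at h ⊢ <;> linarith

theorem perm_eq_of_lt_imp_le : ∀ σ τ : Equiv.Perm (Fin 3),
    (∀ i j, σ i < σ j → τ i ≤ τ j) → σ = τ := by
  decide

/-- Two Kuhn tetrahedra of the same lattice coincide if one contains an interior point of the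
other: the base point is the integer part of the Kuhn coordinates of this point, and the edge path
sorts their fractional parts. -/
theorem kuhn_eq_of_interior {T : Tet} (h : AffineIndependent ℝ T) {N : ℕ} (hN : N ≠ 0)
    {p p' : Fin 3 → ℤ} {σ σ' : Equiv.Perm (Fin 3)} {x : E3}
    (hx : x ∈ interior (kuhn T N p σ).body) (hx' : x ∈ (kuhn T N p' σ').body) :
    p = p' ∧ σ = σ' := by
  have hi := affineIndependent_kuhn h hN p σ
  rw [Tet.interior_body hi] at hx
  obtain ⟨c', hc', hs', e'⟩ := Tet.mem_body.1 hx'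
  set c : Fin 4 → ℝ := fun m => (kuhn T N p σ).bary m x with hc
  have hs : ∑ m, c m = 1 := Tet.sum_bary hi x
  have e : ∑ m, c m • kuhn T N p σ m = x := Tet.sum_bary_smul hi x
  rw [sum_smul_kuhn _ _ _ _ hs] at e
  rw [sum_smul_kuhn _ _ _ _ hs', ← e] at e'
  have e1 := kuhnPoint_injective h (Nat.cast_ne_zero.mpr hN) e'
  have hpos : ∀ n, 0 < c n := hx
  have hp : p = p' := by
    ext j
    have a := congrFun e1 j
    have b1 := tailSum_pos hpos (σ j)
    have b2 := tailSum_lt_one hpos hs (σ j)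
    have b3 := tailSum_nonneg hc' (σ' j)
    have b4 := tailSum_le_one hc' hs' (σ' j)
    have c1 : (p j : ℝ) < p' j + 1 := by linarith
    have c2 : (p' j : ℝ) < p j + 1 := by linarith
    have c3 : p j < p' j + 1 := by exact_mod_cast c1
    have c4 : p' j < p j + 1 := by exact_mod_cast c2
    omega
  refine ⟨hp, perm_eq_of_lt_imp_le _ _ fun i j hij => ?_⟩
  by_contra! hlt
  have a := tailSum_strictAnti hpos hij
  have b := tailSum_anti hc' hlt.le
  have a1 := congrFun e1 i
  have a2 := congrFun e1 j
  simp only [hp] at a1 a2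
  linarith

/-- A lattice point in a Kuhn tetrahedron is one of its vertices. -/
theorem exists_vertex_of_lattice {T : Tet} (h : AffineIndependent ℝ T) {N : ℕ} (hN : N ≠ 0)
    {p P : Fin 3 → ℤ} {σ : Equiv.Perm (Fin 3)}
    (hx : kuhnPoint T N (fun j => (P j : ℝ)) ∈ (kuhn T N p σ).body) :
    ∃ m, kuhn T N p σ m = kuhnPoint T N (fun j => (P j : ℝ)) := by
  obtain ⟨c, hc, hs, e⟩ := Tet.mem_body.1 hx
  rw [sum_smul_kuhn _ _ _ _ hs] at e
  have e1 := kuhnPoint_injective h (Nat.cast_ne_zero.mpr hN) e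
  set z : Fin 3 → ℤ := fun r => P (σ.symm r) - p (σ.symm r) with hz
  have hzt : ∀ r, (z r : ℝ) = tailSum c r := by
    intro r
    have := congrFun e1 (σ.symm r)
    simp only [Equiv.apply_symm_apply] at this
    rw [hz]
    push_cast
    linarith
  have z0 : ∀ r, 0 ≤ z r := fun r => by
    have := tailSum_nonneg hc r
    rw [← hzt] at this
    exact_mod_cast this
  have z1 : ∀ r, z r ≤ 1 := fun r => by
    have := tailSum_le_one hc hs r
    rw [← hzt] at this
    exact_mod_cast this
  have za : ∀ r s, r ≤ s → z s ≤ z r := fun r s hrs => by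
    have := tailSum_anti hc hrs
    rw [← hzt, ← hzt] at this
    exact_mod_cast this
  have hm : ∃ m : Fin 4, ∀ r : Fin 3, z r = if (r : ℕ) < (m : ℕ) then 1 else 0 := by
    have a01 := za 0 1 (by decide)
    have a12 := za 1 2 (by decide)
    have b0 := z0 0
    have b1 := z0 1
    have b2 := z0 2
    have d0 := z1 0
    have d1 := z1 1
    have d2 := z1 2
    by_cases h2 : z 2 = 1
    · refine ⟨3, fun r => ?_⟩
      fin_cases r <;> simp <;> omega
    by_cases h1 : z 1 = 1
    · refine ⟨2, fun r => ?_⟩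
      fin_cases r <;> simp <;> omega
    by_cases h0 : z 0 = 1
    · refine ⟨1, fun r => ?_⟩
      fin_cases r <;> simp <;> omega
    · refine ⟨0, fun r => ?_⟩
      fin_cases r <;> simp <;> omega
  obtain ⟨m, hm⟩ := hm
  refine ⟨m, ?_⟩
  rw [kuhn]
  congr 1
  ext j
  have := hm (σ j)
  simp only [hz, Equiv.symm_apply_apply] at this
  rw [pathOffset, ← this]
  push_cast
  ring

/-! ### Bey's refinement in Kuhn coordinates -/

/-- Lattice offset of the base point of the child `q`, as a vertex number of the parent. -/
def childBase : Fin 8 → Fin 4 := ![0, 1, 2, 3, 1, 1, 2, 2]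

/-- How the steps of the edge path are reordered in the child `q`. -/
def childPerm : Fin 8 → Equiv.Perm (Fin 3) :=
  ![1, 1, 1, 1, (finRotate 3)⁻¹, Equiv.swap 0 1, finRotate 3, Equiv.swap 1 2]

/-- One of the two parent vertices with midpoint the vertex `m` of the child `q`. -/
def childVertexA : Fin 8 → Fin 4 → Fin 4 :=
  ![![0, 0, 0, 0], ![0, 1, 1, 1], ![0, 1, 2, 2], ![0, 1, 2, 3],
    ![0, 0, 0, 1], ![0, 0, 1, 1], ![0, 0, 1, 2], ![0, 1, 1, 2]]

/-- The other parent vertex with midpoint the vertex `m` of the child `q`. -/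
def childVertexB : Fin 8 → Fin 4 → Fin 4 :=
  ![![0, 1, 2, 3], ![1, 1, 2, 3], ![2, 2, 2, 3], ![3, 3, 3, 3],
    ![1, 2, 3, 3], ![1, 2, 2, 3], ![2, 3, 3, 3], ![2, 2, 3, 3]]

theorem children_apply (t : Tet) (q : Fin 8) (m : Fin 4) :
    t.children q m = midpoint ℝ (t (childVertexA q m)) (t (childVertexB q m)) := by
  fin_cases q <;> fin_cases m <;>
    simp [Tet.children, Tet.mid, childVertexA, childVertexB]

/-- Bey's vertex numbering in lattice terms: the offsets of the two parent vertices with midpoint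
the vertex `m` of the child `q` add up to the offset of its base point plus `m` steps of its path.
Here `r` is the position, in the path of the parent, of the step in the direction considered. -/
theorem child_offset : ∀ (q : Fin 8) (m : Fin 4) (r : Fin 3),
    ((if (r : ℕ) < (childVertexA q m : ℕ) then 1 else 0) +
      (if (r : ℕ) < (childVertexB q m : ℕ) then 1 else 0) : ℤ) =
    (if (r : ℕ) < (childBase q : ℕ) then 1 else 0) +
      if (childPerm q r : ℕ) < (m : ℕ) then 1 else 0 := by
  decide

/-- Bey's children of a Kuhn tetrahedron are Kuhn tetrahedra of the lattice with half the width. -/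
theorem children_kuhn (T : Tet) (N : ℕ) (p : Fin 3 → ℤ) (σ : Equiv.Perm (Fin 3)) (q : Fin 8) :
    (kuhn T N p σ).children q =
      kuhn T (2 * N) (fun j => 2 * p j + pathOffset σ (childBase q) j) (σ.trans (childPerm q)) := by
  ext1 m
  rw [children_apply]
  simp only [kuhn]
  rw [midpoint_kuhnPoint]
  push_cast
  congr 1
  ext j
  have := child_offset q m (σ j)
  have h2 : (pathOffset σ (childVertexA q m) j + pathOffset σ (childVertexB q m) j : ℝ) =
      pathOffset σ (childBase q) j + pathOffset (σ.trans (childPerm q)) m j := by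
    unfold pathOffset
    exact_mod_cast this
  simp only [Pi.add_apply]
  linarith

/-- The Kuhn tetrahedron `kuhn T N p σ` lies in `T`: its Kuhn coordinates satisfy
`N ≥ y 0 ≥ y 1 ≥ y 2 ≥ 0`. -/
structure KuhnInside (N : ℕ) (p : Fin 3 → ℤ) (σ : Equiv.Perm (Fin 3)) : Prop where
  le_N : p 0 + 1 ≤ N
  le₁ : p 1 ≤ p 0
  le₂ : p 2 ≤ p 1
  nonneg : 0 ≤ p 2
  lt₁ : p 0 = p 1 → σ 0 < σ 1
  lt₂ : p 1 = p 2 → σ 1 < σ 2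

/-- Two directions that are not separated by the base point of a child keep their order in its
path. -/
theorem childPerm_lt : ∀ (q : Fin 8) (r s : Fin 3), r < s →
    (((if (r : ℕ) < (childBase q : ℕ) then 1 else 0) : ℤ) =
      if (s : ℕ) < (childBase q : ℕ) then 1 else 0) → childPerm q r < childPerm q s := by
  decide

theorem pathOffset_cases (σ : Equiv.Perm (Fin 3)) (m : Fin 4) (j : Fin 3) :
    pathOffset σ m j = 0 ∨ pathOffset σ m j = 1 := by
  unfold pathOffset
  split_ifs <;> simp

theorem pathOffset_anti {σ : Equiv.Perm (Fin 3)} {m : Fin 4} {i j : Fin 3} (h : σ i < σ j) :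
    pathOffset σ m j ≤ pathOffset σ m i := by
  unfold pathOffset
  split_ifs <;> omega

theorem KuhnInside.child {N : ℕ} {p : Fin 3 → ℤ} {σ : Equiv.Perm (Fin 3)} (h : KuhnInside N p σ)
    (q : Fin 8) : KuhnInside (2 * N) (fun j => 2 * p j + pathOffset σ (childBase q) j)
      (σ.trans (childPerm q)) := by
  obtain ⟨h0, h1, h2, h3, h4, h5⟩ := h
  have o0 := pathOffset_cases σ (childBase q) 0
  have o1 := pathOffset_cases σ (childBase q) 1
  have o2 := pathOffset_cases σ (childBase q) 2
  have a1 := fun H => pathOffset_anti (m := childBase q) (h4 H)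
  have a2 := fun H => pathOffset_anti (m := childBase q) (h5 H)
  constructor
  · push_cast
    omega
  · by_cases H : p 0 = p 1
    · have := a1 H
      omega
    · omega
  · by_cases H : p 1 = p 2
    · have := a2 H
      omega
    · omega
  · omega
  · intro H
    have H' : p 0 = p 1 := by omega
    exact childPerm_lt q _ _ (h4 H') (by unfold pathOffset at H; omega)
  · intro H
    have H' : p 1 = p 2 := by omega
    exact childPerm_lt q _ _ (h5 H') (by unfold pathOffset at H; omega)

/-- The parent of a Kuhn tetrahedron is found by stably sorting the edge path by the parity of the
base point. -/
theorem exists_parent_perm : ∀ (r : Fin 3 → Fin 2) (σ' : Equiv.Perm (Fin 3)),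
    ∃ (q : Fin 8) (σ : Equiv.Perm (Fin 3)), σ' = σ.trans (childPerm q) ∧
      (∀ j, ((σ j : ℕ) < (childBase q : ℕ) ↔ r j = 1)) ∧
      ∀ i j, (r j < r i → σ i < σ j) ∧ (r i = r j → σ' i < σ' j → σ i < σ j) := by
  decide

theorem KuhnInside.exists_parent {N : ℕ} {p' : Fin 3 → ℤ} {σ' : Equiv.Perm (Fin 3)}
    (h : KuhnInside (2 * N) p' σ') : ∃ (q : Fin 8) (p : Fin 3 → ℤ) (σ : Equiv.Perm (Fin 3)),
      KuhnInside N p σ ∧ p' = (fun j => 2 * p j + pathOffset σ (childBase q) j) ∧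
      σ' = σ.trans (childPerm q) := by
  obtain ⟨h0, h1, h2, h3, h4, h5⟩ := h
  push_cast at h0
  obtain ⟨q, σ, e, hb, hσ⟩ := exists_parent_perm (fun j => if p' j % 2 = 0 then 0 else 1) σ'
  have hr : ∀ j, p' j = 2 * (p' j / 2) + pathOffset σ (childBase q) j := by
    intro j
    have := hb j
    unfold pathOffset
    by_cases hj : p' j % 2 = 0
    · simp only [hj, if_true] at this
      rw [if_neg (by rw [this]; decide)]
      omega
    · simp only [hj, if_false] at this
      rw [if_pos (this.2 trivial)]
      omega
  have hlt : ∀ i j, p' j ≤ p' i → (p' i = p' j → σ' i < σ' j) → p' i / 2 = p' j / 2 →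
      σ i < σ j := by
    intro i j hle hl he
    obtain ⟨A, B⟩ := hσ i j
    by_cases hi : p' i % 2 = 0 <;> by_cases hj : p' j % 2 = 0
    · exact B (by simp [hi, hj]) (hl (by omega))
    · omega
    · exact A (by simp [hi, hj])
    · exact B (by simp [hi, hj]) (hl (by omega))
  refine ⟨q, fun j => p' j / 2, σ, ⟨?_, ?_, ?_, ?_, hlt 0 1 h1 h4, hlt 1 2 h2 h5⟩, funext hr, e⟩
  all_goals omega

theorem kuhn_one (T : Tet) : kuhn T 1 0 1 = T := by
  ext1 m
  fin_cases m <;> simp [kuhn, kuhnPoint, kuhnWeight, pathOffset, Fin.sum_univ_four]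

theorem perm_eq_one : ∀ σ : Equiv.Perm (Fin 3), σ 0 < σ 1 → σ 1 < σ 2 → σ = 1 := by
  decide

/-- Bey's refinement of `T` consists of the Kuhn tetrahedra of the lattice of width `2⁻ˡ` that lie
in `T`. -/
theorem mem_refine {T : Tet} {ℓ : ℕ} {t : Tet} :
    t ∈ T.refine ℓ ↔ ∃ p σ, KuhnInside (2 ^ ℓ) p σ ∧ t = kuhn T (2 ^ ℓ) p σ := by
  induction ℓ generalizing t with
  | zero =>
    simp only [Tet.refine, Finset.mem_singleton, pow_zero]
    constructor
    · rintro rfl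
      exact ⟨0, 1, ⟨by simp, by simp, by simp, by simp, by simp, by simp⟩, (kuhn_one t).symm⟩
    · rintro ⟨p, σ, ⟨h0, h1, h2, h3, h4, h5⟩, rfl⟩
      have hp : p = 0 := by
        ext j
        fin_cases j <;> simp <;> omega
      rw [perm_eq_one σ (h4 (by omega)) (h5 (by omega)), hp, kuhn_one]
  | succ ℓ ih =>
    simp only [Tet.refine, Finset.mem_biUnion, Finset.mem_image, Finset.mem_univ, true_and, ih]
    constructor
    · rintro ⟨_, ⟨p, σ, h, rfl⟩, q, rfl⟩
      refine ⟨fun j => 2 * p j + pathOffset σ (childBase q) j, σ.trans (childPerm q), ?_, ?_⟩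
      · rw [pow_succ']
        exact h.child q
      · rw [children_kuhn, pow_succ']
    · rintro ⟨p', σ', h, rfl⟩
      rw [pow_succ'] at h
      obtain ⟨q, p, σ, h', rfl, rfl⟩ := h.exists_parent
      exact ⟨_, ⟨p, σ, h', rfl⟩, q, by rw [children_kuhn, pow_succ']⟩

theorem affineIndependent_of_mem_refine {T t : Tet} (h : AffineIndependent ℝ T) {ℓ : ℕ}
    (ht : t ∈ T.refine ℓ) : AffineIndependent ℝ t := by
  obtain ⟨p, σ, -, rfl⟩ := mem_refine.1 ht
  exact affineIndependent_kuhn h (by positivity) p σ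

theorem eq_of_interior_refine {T t t' : Tet} (h : AffineIndependent ℝ T) {ℓ : ℕ}
    (ht : t ∈ T.refine ℓ) (ht' : t' ∈ T.refine ℓ) {x : E3} (hx : x ∈ interior t.body)
    (hx' : x ∈ t'.body) : t = t' := by
  obtain ⟨p, σ, -, rfl⟩ := mem_refine.1 ht
  obtain ⟨p', σ', -, rfl⟩ := mem_refine.1 ht'
  obtain ⟨rfl, rfl⟩ := kuhn_eq_of_interior h (by positivity) hx hx'
  rfl

theorem Tet.children_body_subset (t : Tet) (q : Fin 8) : (t.children q).body ⊆ t.body := by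
  refine convexHull_min ?_ t.convex_body
  rintro _ ⟨m, rfl⟩
  rw [children_apply]
  exact t.convex_body.midpoint_mem (t.vertex_mem_body _) (t.vertex_mem_body _)

/-- The eight children cover their parent; which child contains a point is read off from the
order of its doubled Kuhn coordinates. -/
theorem Tet.exists_child_of_mem_body {t : Tet} {x : E3} (hx : x ∈ t.body) :
    ∃ q, x ∈ (t.children q).body := by
  obtain ⟨c, hc, hs, rfl⟩ := Tet.mem_body.1 hx
  rw [Fin.sum_univ_four] at hs
  have hc0 := hc 0
  have hc1 := hc 1
  have hc2 := hc 2
  have hc3 := hc 3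
  have e0 : c 0 = 1 - c 1 - c 2 - c 3 := by linarith
  have key : ∀ q (d : Fin 4 → ℝ), (∀ n, 0 ≤ d n) → ∑ n, d n = 1 →
      ∑ n, d n • t.children q n = ∑ n, c n • t n → ∃ q, ∑ n, c n • t n ∈ (t.children q).body :=
    fun q d h1 h2 h3 => ⟨q, Tet.mem_body.2 ⟨d, h1, h2, h3⟩⟩
  have build : ∀ (q : Fin 8) (a b g : ℝ), a ≤ 1 → b ≤ a → g ≤ b → 0 ≤ g →
      ∑ n, (![1 - a, a - b, b - g, g] : Fin 4 → ℝ) n • t.children q n = ∑ n, c n • t n →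
      ∃ q, ∑ n, c n • t n ∈ (t.children q).body := by
    intro q a b g h1 h2 h3 h4 h5
    refine key q _ (fun n => ?_) ?_ h5
    · fin_cases n <;> simp <;> linarith
    · simp [Fin.sum_univ_four]
  -- `α ≥ β ≥ γ` are the Kuhn coordinates of the point in the lattice of half the width.
  set α := 2 * (c 1 + c 2 + c 3) with hα
  set β := 2 * (c 2 + c 3) with hβ
  set γ := 2 * c 3 with hγ
  have c1 : c 1 = (α - β) / 2 := by linarith
  have c2 : c 2 = (β - γ) / 2 := by linarith
  have c3 : c 3 = γ / 2 := by linarith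
  have c0 : c 0 = 1 - α / 2 := by linarith
  have fin : ∀ (q : Fin 8) (a b g : ℝ),
      (∑ n, (![1 - a, a - b, b - g, g] : Fin 4 → ℝ) n •
        ((1 / 2 : ℝ) • (t (childVertexA q n) + t (childVertexB q n)))
        = (1 - α / 2) • t 0 + ((α - β) / 2) • t 1 + ((β - γ) / 2) • t 2 + (γ / 2) • t 3) →
      ∑ n, (![1 - a, a - b, b - g, g] : Fin 4 → ℝ) n • t.children q n = ∑ n, c n • t n := by
    intro q a b g H
    simp only [children_apply, midpoint_eq_smul_add, invOf_eq_inv]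
    rw [Fin.sum_univ_four (fun n => c n • t n), c0, c1, c2, c3, ← H]
    norm_num
  clear_value α β γ
  by_cases h1 : α ≤ 1
  · refine build 0 α β γ h1 (by linarith) (by linarith) (by linarith) (fin _ _ _ _ ?_)
    simp [Fin.sum_univ_four, childVertexA, childVertexB]
    module
  by_cases h2 : 1 ≤ γ
  · refine build 3 (α - 1) (β - 1) (γ - 1) (by linarith) (by linarith) (by linarith) (by linarith)
      (fin _ _ _ _ ?_)
    simp [Fin.sum_univ_four, childVertexA, childVertexB]
    module
  by_cases h3 : β ≤ 1
  · by_cases h4 : β ≤ α - 1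
    · refine build 1 (α - 1) β γ (by linarith) (by linarith) (by linarith) (by linarith)
        (fin _ _ _ _ ?_)
      simp [Fin.sum_univ_four, childVertexA, childVertexB]
      module
    by_cases h5 : γ ≤ α - 1
    · refine build 5 β (α - 1) γ (by linarith) (by linarith) (by linarith) (by linarith)
        (fin _ _ _ _ ?_)
      simp [Fin.sum_univ_four, childVertexA, childVertexB]
      module
    · refine build 4 β γ (α - 1) (by linarith) (by linarith) (by linarith) (by linarith)
        (fin _ _ _ _ ?_)
      simp [Fin.sum_univ_four, childVertexA, childVertexB]
      module
  · by_cases h4 : γ ≤ β - 1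
    · refine build 2 (α - 1) (β - 1) γ (by linarith) (by linarith) (by linarith) (by linarith)
        (fin _ _ _ _ ?_)
      simp [Fin.sum_univ_four, childVertexA, childVertexB]
      module
    by_cases h5 : γ ≤ α - 1
    · refine build 7 (α - 1) γ (β - 1) (by linarith) (by linarith) (by linarith) (by linarith)
        (fin _ _ _ _ ?_)
      simp [Fin.sum_univ_four, childVertexA, childVertexB]
      module
    · refine build 6 γ (α - 1) (β - 1) (by linarith) (by linarith) (by linarith) (by linarith)
        (fin _ _ _ _ ?_)
      simp [Fin.sum_univ_four, childVertexA, childVertexB]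
      module

theorem mem_body_iff_refine {T : Tet} (ℓ : ℕ) {x : E3} :
    x ∈ T.body ↔ ∃ t ∈ T.refine ℓ, x ∈ t.body := by
  induction ℓ with
  | zero => simp [Tet.refine]
  | succ ℓ ih =>
    rw [ih]
    simp only [Tet.refine, Finset.mem_biUnion, Finset.mem_image, Finset.mem_univ, true_and]
    constructor
    · rintro ⟨t, ht, hx⟩
      obtain ⟨q, hq⟩ := Tet.exists_child_of_mem_body hx
      exact ⟨_, ⟨t, ht, q, rfl⟩, hq⟩
    · rintro ⟨_, ⟨t, ht, q, rfl⟩, hx⟩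
      exact ⟨t, ht, t.children_body_subset q hx⟩

/-- The lattice points of width `1 / N` of a tetrahedron, in barycentric coordinates. -/
def Tet.IsLattice (T : Tet) (N : ℕ) (x : E3) : Prop := ∀ m, ∃ z : ℤ, N * T.bary m x = z

theorem Tet.IsLattice.exists_kuhnPoint {T : Tet} (h : AffineIndependent ℝ T) {N : ℕ} (hN : N ≠ 0)
    {x : E3} (hx : T.IsLattice N x) :
    ∃ P : Fin 3 → ℤ, x = kuhnPoint T N fun j => (P j : ℝ) := by
  choose z hz using hx
  refine ⟨![z 1 + z 2 + z 3, z 2 + z 3, z 3],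
    (kuhnPoint_bary h (Nat.cast_ne_zero.mpr hN) ?_ ?_ ?_).symm⟩
  · simp [← hz]
    ring
  · simp [← hz]
    ring
  · simp [← hz]

theorem isLattice_kuhnPoint {T : Tet} (h : AffineIndependent ℝ T) {N : ℕ} (hN : N ≠ 0)
    (P : Fin 3 → ℤ) : T.IsLattice N (kuhnPoint T N fun j => (P j : ℝ)) := by
  have hN' : (N : ℝ) ≠ 0 := Nat.cast_ne_zero.mpr hN
  intro m
  refine ⟨(![N - P 0, P 0 - P 1, P 1 - P 2, P 2] : Fin 4 → ℤ) m, ?_⟩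
  rw [bary_kuhnPoint h]
  fin_cases m <;> simp [kuhnWeight] <;> field_simp

theorem isLattice_of_mem_refine {T t : Tet} (h : AffineIndependent ℝ T) {ℓ : ℕ}
    (ht : t ∈ T.refine ℓ) (m : Fin 4) : T.IsLattice (2 ^ ℓ) (t m) := by
  obtain ⟨p, σ, -, rfl⟩ := mem_refine.1 ht
  exact isLattice_kuhnPoint h (by positivity) _

theorem exists_vertex_of_isLattice {T t : Tet} (h : AffineIndependent ℝ T) {ℓ : ℕ}
    (ht : t ∈ T.refine ℓ) {x : E3} (hx : T.IsLattice (2 ^ ℓ) x) (hxt : x ∈ t.body) :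
    ∃ m, t m = x := by
  obtain ⟨p, σ, -, rfl⟩ := mem_refine.1 ht
  obtain ⟨P, rfl⟩ := hx.exists_kuhnPoint h (by positivity)
  exact exists_vertex_of_lattice h (by positivity) hxt

/-! ### Cancellation over vertex patches -/

/-- The contribution of the edge from `t m` to `t n` in the tetrahedron `t` to the difference
between the row of `t m` in the stencil-scaled form and the row in the nodal form. -/
def edgeDefect (k v : E3 → ℝ) (t : Tet) (m n : Fin 4) : ℝ :=
  ((k (t m) + k (t n)) / 2 - (∑ l, k (t l)) / 4) * (v (t n) - v (t m)) * t.stiff m n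

theorem affine_add_sub (a : E3 →ᵃ[ℝ] ℝ) (x y z : E3) : a (x + y - z) = a x + a y - a z := by
  have h1 := affine_sub a (x + y - z) x
  have h2 := affine_sub a y z
  rw [show x + y - z - x = y - z by abel] at h1
  linarith

theorem sum_comp_rev (F : Fin 4 → ℝ) : ∑ l : Fin 4, F l.rev = ∑ l, F l :=
  Equiv.sum_comp Fin.revPerm F

/-- Point reflection at the midpoint of an edge changes the sign of the contribution of this
edge, because the coefficient means of the two tetrahedra average to its midpoint value. -/
theorem edgeDefect_reflect_edge (k : E3 →ᵃ[ℝ] ℝ) (v : E3 → ℝ) {t t' : Tet}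
    (h : AffineIndependent ℝ t) {m n : Fin 4} (hc : ∀ l, t' l.rev = t m + t n - t l) :
    edgeDefect k v t' n.rev m.rev = - edgeDefect k v t m n := by
  have hm : t' m.rev = t n := by rw [hc]; abel
  have hn : t' n.rev = t m := by rw [hc]; abel
  have hs : ∑ l, k (t' l) = 4 * (k (t m) + k (t n)) - ∑ l, k (t l) := by
    rw [← sum_comp_rev fun l => k (t' l)]
    simp only [hc, affine_add_sub, Fin.sum_univ_four]
    ring
  rw [edgeDefect, edgeDefect, Tet.stiff_reflect h hc, hm, hn, hs, Tet.stiff_comm]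
  ring

/-- Point reflection at the node leaves the contributions of its edges unchanged. -/
theorem edgeDefect_reflect_node (k u : E3 →ᵃ[ℝ] ℝ) {t t' : Tet}
    (h : AffineIndependent ℝ t) {m : Fin 4} (hc : ∀ l, t' l.rev = t m + t m - t l) (n : Fin 4) :
    edgeDefect k u t' m.rev n.rev = edgeDefect k u t m n := by
  have hs : ∑ l, k (t' l) = 8 * k (t m) - ∑ l, k (t l) := by
    rw [← sum_comp_rev fun l => k (t' l)]
    simp only [hc, affine_add_sub, Fin.sum_univ_four]
    ring
  rw [edgeDefect, edgeDefect, Tet.stiff_reflect h hc, hs]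
  simp only [hc, affine_add_sub]
  ring

theorem kuhnPoint_add_sub (T : Tet) (N : ℝ) (a b d : Fin 3 → ℝ) :
    kuhnPoint T N a + kuhnPoint T N b - kuhnPoint T N d = kuhnPoint T N (a + b - d) := by
  simp only [kuhnPoint, ← Finset.sum_add_distrib, ← Finset.sum_sub_distrib, ← add_smul, ← sub_smul]
  refine Finset.sum_congr rfl fun m _ => ?_
  congr 1
  fin_cases m <;> simp [kuhnWeight] <;> ring

/-- The edge path of `σ` traversed backwards. -/
def revPath (σ : Equiv.Perm (Fin 3)) : Equiv.Perm (Fin 3) := σ.trans Fin.revPerm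

theorem revPath_revPath (σ : Equiv.Perm (Fin 3)) : revPath (revPath σ) = σ := by
  ext j
  simp [revPath]

theorem pathOffset_revPath (σ : Equiv.Perm (Fin 3)) (m : Fin 4) (j : Fin 3) :
    pathOffset (revPath σ) m.rev j = 1 - pathOffset σ m j := by
  simp only [pathOffset, revPath, Equiv.trans_apply, Fin.revPerm_apply, Fin.val_rev]
  split_ifs <;> omega

/-- The Kuhn tetrahedron with edge path `σ` whose `m`-th vertex is the lattice point `P`. -/
def patchTet (T : Tet) (N : ℕ) (P : Fin 3 → ℤ) (σ : Equiv.Perm (Fin 3)) (m : Fin 4) : Tet :=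
  kuhn T N (P - pathOffset σ m) σ

theorem patchTet_self (T : Tet) (N : ℕ) (P : Fin 3 → ℤ) (σ : Equiv.Perm (Fin 3)) (m : Fin 4) :
    patchTet T N P σ m m = kuhnPoint T N fun j => (P j : ℝ) := by
  simp [patchTet, kuhn]

theorem patchTet_reflect (T : Tet) (N : ℕ) (P : Fin 3 → ℤ) (σ : Equiv.Perm (Fin 3))
    (m n l : Fin 4) : patchTet T N P (revPath σ) n.rev l.rev =
      patchTet T N P σ m m + patchTet T N P σ m n - patchTet T N P σ m l := by
  simp only [patchTet, kuhn]
  rw [kuhnPoint_add_sub]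
  congr 1
  ext j
  simp only [Pi.sub_apply, Pi.add_apply, pathOffset_revPath]
  push_cast
  ring

/-- The involution of (path, vertex, vertex) that encodes the reflection at an edge midpoint. -/
def edgeReflection : Equiv.Perm (Equiv.Perm (Fin 3) × Fin 4 × Fin 4) :=
  Function.Involutive.toPerm (fun x => (revPath x.1, x.2.2.rev, x.2.1.rev)) fun x => by
    simp [revPath_revPath]

/-- Over a full lattice patch all contributions cancel in pairs of tetrahedra that are exchanged by
the reflection at the midpoint of a common edge. -/
theorem sum_full_patch {T : Tet} (h : AffineIndependent ℝ T) {N : ℕ} (hN : N ≠ 0)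
    (P : Fin 3 → ℤ) (k : E3 →ᵃ[ℝ] ℝ) (v : E3 → ℝ) :
    ∑ σ, ∑ m, ∑ n, edgeDefect k v (patchTet T N P σ m) m n = 0 := by
  have h1 : ∑ σ, ∑ m, ∑ n, edgeDefect k v (patchTet T N P σ m) m n =
      ∑ x : Equiv.Perm (Fin 3) × Fin 4 × Fin 4,
        edgeDefect k v (patchTet T N P x.1 x.2.1) x.2.1 x.2.2 := by
    simp only [Fintype.sum_prod_type]
  have h2 := Equiv.sum_comp edgeReflection fun x : Equiv.Perm (Fin 3) × Fin 4 × Fin 4 =>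
    edgeDefect k v (patchTet T N P x.1 x.2.1) x.2.1 x.2.2
  have h3 : ∀ x : Equiv.Perm (Fin 3) × Fin 4 × Fin 4,
      edgeDefect k v (patchTet T N P (edgeReflection x).1 (edgeReflection x).2.1)
        (edgeReflection x).2.1 (edgeReflection x).2.2 =
      - edgeDefect k v (patchTet T N P x.1 x.2.1) x.2.1 x.2.2 := by
    rintro ⟨σ, m, n⟩
    exact edgeDefect_reflect_edge k v (affineIndependent_kuhn h hN _ _)
      fun l => patchTet_reflect T N P σ m n l
  simp only [h3, Finset.sum_neg_distrib] at h2
  rw [h1]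
  linarith

open Classical in
/-- The tetrahedra of the refinement that have the lattice point `P` as a vertex are the members of
the full lattice patch of `P` that lie in the macro-element. -/
theorem sum_refine_patch {T : Tet} (h : AffineIndependent ℝ T) (ℓ : ℕ) (P : Fin 3 → ℤ)
    (F : Tet → Fin 4 → ℝ) :
    ∑ t ∈ T.refine ℓ, ∑ m, (if t m = kuhnPoint T (2 ^ ℓ : ℕ) (fun j => (P j : ℝ)) then F t m else 0)
    = ∑ σ, ∑ m, if KuhnInside (2 ^ ℓ) (P - pathOffset σ m) σ then
        F (patchTet T (2 ^ ℓ) P σ m) m else 0 := by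
  have hN : (2 ^ ℓ : ℕ) ≠ 0 := by positivity
  rw [← Finset.sum_product', ← Finset.sum_filter, ← Fintype.sum_prod_type', ← Finset.sum_filter]
  symm
  refine Finset.sum_nbij (fun x => (patchTet T (2 ^ ℓ) P x.1 x.2, x.2)) ?_ ?_ ?_ fun _ _ => rfl
  · rintro ⟨σ, m⟩ hx
    simp only [Finset.mem_filter, Finset.mem_univ, true_and] at hx
    simp only [Finset.mem_filter, Finset.mem_product, Finset.mem_univ, and_true]
    exact ⟨mem_refine.2 ⟨_, _, hx, rfl⟩, patchTet_self _ _ _ _ _⟩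
  · rintro ⟨σ, m⟩ - ⟨σ', m'⟩ - e
    simp only [Prod.mk.injEq] at e
    obtain ⟨e, rfl⟩ := e
    obtain ⟨x, hx⟩ := Tet.interior_body_nonempty
      (affineIndependent_kuhn h hN (P - pathOffset σ m) σ)
    have hx' := interior_subset hx
    have e' : kuhn T (2 ^ ℓ) (P - pathOffset σ m) σ = kuhn T (2 ^ ℓ) (P - pathOffset σ' m) σ' := e
    rw [e'] at hx'
    exact Prod.ext (kuhn_eq_of_interior h hN hx hx').2 rfl
  · rintro ⟨t, m⟩ hx
    simp only [Finset.coe_filter, Finset.mem_product, Finset.mem_univ, and_true,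
      Set.mem_ofPred_eq] at hx
    obtain ⟨ht, hm⟩ := hx
    obtain ⟨p, σ, hin, rfl⟩ := mem_refine.1 ht
    have e1 := kuhnPoint_injective h (Nat.cast_ne_zero.mpr hN) hm
    have e2 : p = P - pathOffset σ m := by
      ext j
      have := congrFun e1 j
      simp only [Int.cast_inj] at this
      simp only [Pi.sub_apply]
      omega
    subst e2
    exact ⟨(σ, m), by simpa using hin, rfl⟩

/-- The full lattice patch of an interior lattice point lies in the macro-element. -/
theorem kuhnInside_of_interior {N : ℕ} {P : Fin 3 → ℤ} (h0 : P 0 < N) (h1 : P 1 < P 0)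
    (h2 : P 2 < P 1) (h3 : 0 < P 2) (σ : Equiv.Perm (Fin 3)) (m : Fin 4) :
    KuhnInside N (P - pathOffset σ m) σ := by
  have o0 := pathOffset_cases σ m 0
  have o1 := pathOffset_cases σ m 1
  have o2 := pathOffset_cases σ m 2
  have anti : ∀ i j, pathOffset σ m i < pathOffset σ m j → σ j < σ i := by
    intro i j hij
    by_contra! hle
    rcases hle.lt_or_eq with hl | he
    · have := pathOffset_anti (m := m) hl
      omega
    · rw [σ.injective he] at hij
      exact lt_irrefl _ hij
  constructor
  · simp only [Pi.sub_apply]; omega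
  · simp only [Pi.sub_apply]; omega
  · simp only [Pi.sub_apply]; omega
  · simp only [Pi.sub_apply]; omega
  · intro H
    simp only [Pi.sub_apply] at H
    exact anti _ _ (by omega)
  · intro H
    simp only [Pi.sub_apply] at H
    exact anti _ _ (by omega)

theorem kuhnInside_iff {N : ℕ} {p : Fin 3 → ℤ} {σ : Equiv.Perm (Fin 3)} :
    KuhnInside N p σ ↔ p 0 + 1 ≤ N ∧ p 1 ≤ p 0 ∧ p 2 ≤ p 1 ∧ 0 ≤ p 2 ∧
      (p 0 = p 1 → (σ 0 : ℕ) < σ 1) ∧ (p 1 = p 2 → (σ 1 : ℕ) < σ 2) :=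
  ⟨fun ⟨h0, h1, h2, h3, h4, h5⟩ => ⟨h0, h1, h2, h3, h4, h5⟩,
    fun ⟨h0, h1, h2, h3, h4, h5⟩ => ⟨h0, h1, h2, h3, h4, h5⟩⟩

/-- At a lattice point in the relative interior of a face, exactly one of two tetrahedra that are
exchanged by the reflection at this point lies in the simplex. -/
theorem kuhnInside_revPath {N : ℕ} {P : Fin 3 → ℤ} {w : Fin 4 → ℤ} (h0 : w 0 = N - P 0)
    (h1 : w 1 = P 0 - P 1) (h2 : w 2 = P 1 - P 2) (h3 : w 3 = P 2) {i : Fin 4} (hi : w i = 0)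
    (hpos : ∀ n, n ≠ i → 0 < w n) (σ : Equiv.Perm (Fin 3)) (m : Fin 4) :
    KuhnInside N (P - pathOffset (revPath σ) m.rev) (revPath σ) ↔
      ¬ KuhnInside N (P - pathOffset σ m) σ := by
  have o0 := pathOffset_cases σ m 0
  have o1 := pathOffset_cases σ m 1
  have o2 := pathOffset_cases σ m 2
  have a01 : (σ 0 : ℕ) < σ 1 → pathOffset σ m 1 ≤ pathOffset σ m 0 := fun H => pathOffset_anti H
  have a10 : (σ 1 : ℕ) < σ 0 → pathOffset σ m 0 ≤ pathOffset σ m 1 := fun H => pathOffset_anti H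
  have a12 : (σ 1 : ℕ) < σ 2 → pathOffset σ m 2 ≤ pathOffset σ m 1 := fun H => pathOffset_anti H
  have a21 : (σ 2 : ℕ) < σ 1 → pathOffset σ m 1 ≤ pathOffset σ m 2 := fun H => pathOffset_anti H
  have n01 : (σ 0 : ℕ) ≠ σ 1 := fun H => by
    have := σ.injective (Fin.ext H)
    simp at this
  have n12 : (σ 1 : ℕ) ≠ σ 2 := fun H => by
    have := σ.injective (Fin.ext H)
    simp at this
  simp only [kuhnInside_iff, Pi.sub_apply, pathOffset_revPath]
  simp only [revPath, Equiv.trans_apply, Fin.revPerm_apply, Fin.val_rev]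
  have b0 := (σ 0).isLt
  have b1 := (σ 1).isLt
  have b2 := (σ 2).isLt
  generalize (σ 0 : ℕ) = s0 at *
  generalize (σ 1 : ℕ) = s1 at *
  generalize (σ 2 : ℕ) = s2 at *
  generalize pathOffset σ m 0 = x0 at *
  generalize pathOffset σ m 1 = x1 at *
  generalize pathOffset σ m 2 = x2 at *
  have p0 := hpos 0
  have p1 := hpos 1
  have p2 := hpos 2
  have p3 := hpos 3
  fin_cases i <;> simp at p0 p1 p2 p3 hi <;> omega

theorem Tet.IsLattice.exists_coords {T : Tet} (h : AffineIndependent ℝ T) {N : ℕ} (hN : N ≠ 0)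
    {x : E3} (hx : T.IsLattice N x) : ∃ (P : Fin 3 → ℤ) (w : Fin 4 → ℤ),
      x = kuhnPoint T N (fun j => (P j : ℝ)) ∧ w 0 = N - P 0 ∧ w 1 = P 0 - P 1 ∧
      w 2 = P 1 - P 2 ∧ w 3 = P 2 ∧ ∀ m, N * T.bary m x = w m := by
  have hN' : (N : ℝ) ≠ 0 := Nat.cast_ne_zero.mpr hN
  obtain ⟨P, rfl⟩ := hx.exists_kuhnPoint h hN
  refine ⟨P, ![N - P 0, P 0 - P 1, P 1 - P 2, P 2], rfl, rfl, rfl, rfl, rfl, fun m => ?_⟩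
  rw [bary_kuhnPoint h]
  fin_cases m <;> simp [kuhnWeight] <;> field_simp

open Classical in
/-- For an affine coefficient and arbitrary `v`, the contributions of one macro-element to the
difference of the two forms cancel at every lattice point in its interior. -/
theorem sum_edgeDefect_interior {T : Tet} (h : AffineIndependent ℝ T) {ℓ : ℕ} {x : E3}
    (hx : T.IsLattice (2 ^ ℓ) x) (hpos : ∀ m, 0 < T.bary m x) (k : E3 →ᵃ[ℝ] ℝ) (v : E3 → ℝ) :
    ∑ t ∈ T.refine ℓ, ∑ m, (if t m = x then ∑ n, edgeDefect k v t m n else 0) = 0 := by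
  have hN : (2 ^ ℓ : ℕ) ≠ 0 := by positivity
  obtain ⟨P, w, rfl, h0, h1, h2, h3, hw⟩ := hx.exists_coords h hN
  have wpos : ∀ m, 0 < w m := by
    intro m
    have h4 : (0 : ℝ) < w m := by
      rw [← hw]
      exact mul_pos (by positivity) (hpos m)
    exact_mod_cast h4
  have w0 := wpos 0
  have w1 := wpos 1
  have w2 := wpos 2
  have w3 := wpos 3
  rw [sum_refine_patch h ℓ P fun t m => ∑ n, edgeDefect k v t m n]
  rw [← sum_full_patch h hN P k v]
  refine Finset.sum_congr rfl fun σ _ => Finset.sum_congr rfl fun m _ => if_pos ?_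
  exact kuhnInside_of_interior (by omega) (by omega) (by omega) (by omega) σ m

open Classical in
/-- For an affine coefficient and an affine argument, the contributions of one macro-element also
cancel at the lattice points in the relative interior of a face: there the patch is one half of a
full lattice patch, and the reflection at the node exchanges the two halves. -/
theorem sum_edgeDefect_face {T : Tet} (h : AffineIndependent ℝ T) {ℓ : ℕ} {x : E3}
    (hx : T.IsLattice (2 ^ ℓ) x) {i : Fin 4} (hi : T.bary i x = 0)
    (hpos : ∀ m, m ≠ i → 0 < T.bary m x) (k u : E3 →ᵃ[ℝ] ℝ) :
    ∑ t ∈ T.refine ℓ, ∑ m, (if t m = x then ∑ n, edgeDefect k u t m n else 0) = 0 := by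
  have hN : (2 ^ ℓ : ℕ) ≠ 0 := by positivity
  obtain ⟨P, w, rfl, h0, h1, h2, h3, hw⟩ := hx.exists_coords h hN
  have wi : w i = 0 := by
    have := hw i
    rw [hi, mul_zero] at this
    exact_mod_cast this.symm
  have wpos : ∀ m, m ≠ i → 0 < w m := by
    intro m hm
    have h4 : (0 : ℝ) < w m := by
      rw [← hw]
      exact mul_pos (by positivity) (hpos m hm)
    exact_mod_cast h4
  rw [sum_refine_patch h ℓ P fun t m => ∑ n, edgeDefect k u t m n]
  set G : Equiv.Perm (Fin 3) × Fin 4 → ℝ := fun x =>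
    ∑ n, edgeDefect k u (patchTet T (2 ^ ℓ) P x.1 x.2) x.2 n with hG
  set e : Equiv.Perm (Equiv.Perm (Fin 3) × Fin 4) :=
    Function.Involutive.toPerm (fun x => (revPath x.1, x.2.rev)) (fun x => by
      simp [revPath_revPath]) with he
  have hGe : ∀ x, G (e x) = G x := by
    rintro ⟨σ, m⟩
    simp only [hG]
    rw [← sum_comp_rev]
    refine Finset.sum_congr rfl fun n _ => ?_
    exact edgeDefect_reflect_node k u (affineIndependent_kuhn h hN _ _)
      (fun l => patchTet_reflect T (2 ^ ℓ) P σ m m l) n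
  have hfull : ∑ x, G x = 0 := by
    rw [Fintype.sum_prod_type]
    exact sum_full_patch h hN P k u
  have hhalf : ∑ σ, ∑ m, (if KuhnInside (2 ^ ℓ) (P - pathOffset σ m) σ then
      ∑ n, edgeDefect k u (patchTet T (2 ^ ℓ) P σ m) m n else 0) =
      ∑ x : Equiv.Perm (Fin 3) × Fin 4,
        if KuhnInside (2 ^ ℓ) (P - pathOffset x.1 x.2) x.1 then G x else 0 := by
    rw [Fintype.sum_prod_type]
  have hcomp := Equiv.sum_comp e fun x : Equiv.Perm (Fin 3) × Fin 4 =>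
    if KuhnInside (2 ^ ℓ) (P - pathOffset x.1 x.2) x.1 then G x else 0
  have hneg : ∀ x, (if KuhnInside (2 ^ ℓ) (P - pathOffset (e x).1 (e x).2) (e x).1 then G (e x)
      else 0) = G x - if KuhnInside (2 ^ ℓ) (P - pathOffset x.1 x.2) x.1 then G x else 0 := by
    intro x
    rw [hGe]
    have : KuhnInside (2 ^ ℓ) (P - pathOffset (e x).1 (e x).2) (e x).1 ↔
        ¬ KuhnInside (2 ^ ℓ) (P - pathOffset x.1 x.2) x.1 :=
      kuhnInside_revPath h0 h1 h2 h3 wi wpos x.1 x.2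
    by_cases H : KuhnInside (2 ^ ℓ) (P - pathOffset x.1 x.2) x.1
    · rw [if_pos H, if_neg fun H' => this.1 H' H, sub_self]
    · rw [if_neg H, if_pos (this.2 H), sub_zero]
  -- The sum over the half patch equals the full sum, which is zero, minus itself.
  simp only [hneg, Finset.sum_sub_distrib, hfull] at hcomp
  rw [hhalf]
  linarith

/-! ### Conformity of the refined mesh -/

/-- On the common face of two tetrahedra, the barycentric coordinates of the vertices that are not
shared vanish. -/
theorem bary_eq_zero_of_mem_hull {S T : Tet} (hS : AffineIndependent ℝ S) {x : E3}
    (hx : x ∈ convexHull ℝ (Set.range S ∩ Set.range T)) {m : Fin 4} (hm : S m ∉ Set.range T) :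
    S.bary m x = 0 := by
  have hsub : convexHull ℝ (Set.range S ∩ Set.range T) ⊆ (S.bary m) ⁻¹' {0} := by
    refine convexHull_min ?_ ((convex_singleton (0 : ℝ)).affine_preimage (S.bary m))
    rintro _ ⟨⟨n, rfl⟩, hn⟩
    have : m ≠ n := by
      rintro rfl
      exact hm hn
    simp [Tet.bary_vertex hS, this]
  exact hsub hx

/-- On the common face of two tetrahedra, the barycentric coordinates of a shared vertex agree. -/
theorem bary_eq_of_mem_hull {S T : Tet} (hS : AffineIndependent ℝ S) (hT : AffineIndependent ℝ T)
    {x : E3} (hx : x ∈ convexHull ℝ (Set.range S ∩ Set.range T)) {m n : Fin 4} (hmn : S m = T n) :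
    S.bary m x = T.bary n x := by
  have hsub : convexHull ℝ (Set.range S ∩ Set.range T) ⊆ (S.bary m - T.bary n) ⁻¹' {0} := by
    refine convexHull_min ?_ ((convex_singleton (0 : ℝ)).affine_preimage (S.bary m - T.bary n))
    rintro _ ⟨⟨i, rfl⟩, j, hj⟩
    have h1 : (S.bary m - T.bary n) (S i) = S.bary m (S i) - T.bary n (T j) := by
      rw [hj]
      rfl
    have h2 : m = i ↔ n = j := by
      rw [← hS.injective.eq_iff, ← hT.injective.eq_iff, hmn, hj]
    rw [Set.mem_preimage, h1, Tet.bary_vertex hS, Tet.bary_vertex hT]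
    simp [h2]
  have := hsub hx
  have h3 : S.bary m x - T.bary n x = 0 := this
  linarith

/-- The affine interpolant of `v` at the vertices of `t`. -/
def Tet.interp (t : Tet) (v : E3 → ℝ) : E3 →ᵃ[ℝ] ℝ := ∑ m, v (t m) • t.bary m

theorem Tet.interp_apply (t : Tet) (v : E3 → ℝ) (x : E3) :
    t.interp v x = ∑ m, v (t m) * t.bary m x := by
  simp [Tet.interp, Fin.sum_univ_four]

theorem Tet.affineGrad_interp (t : Tet) (v : E3 → ℝ) :
    affineGrad (t.interp v) = ∑ m, v (t m) • affineGrad (t.bary m) := by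
  rw [Tet.interp, affineGrad_sum]
  simp only [affineGrad_smul]

theorem Tet.interp_eq {t : Tet} (h : AffineIndependent ℝ t) {v : E3 → ℝ} {a : E3 →ᵃ[ℝ] ℝ}
    (hv : Set.EqOn v a t.body) : t.interp v = a := by
  rw [Tet.affine_eq_sum h a, Tet.interp]
  exact Finset.sum_congr rfl fun m _ => by rw [hv (t.vertex_mem_body m)]

theorem Tet.volume_inner_affineGrad_interp (t : Tet) (v w : E3 → ℝ) :
    volume.real t.body * inner ℝ (affineGrad (t.interp v)) (affineGrad (t.interp w))
      = ∑ m, ∑ n, v (t m) * w (t n) * t.stiff m n := by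
  simp only [Tet.affineGrad_interp, sum_inner, inner_sum, Finset.mul_sum, Tet.stiff,
    real_inner_smul_left, real_inner_smul_right]
  rw [Finset.sum_comm]
  refine Finset.sum_congr rfl fun m _ => Finset.sum_congr rfl fun n _ => by ring

theorem Tet.sum_stiff {t : Tet} (h : AffineIndependent ℝ t) (m : Fin 4) :
    ∑ n, t.stiff m n = 0 := by
  simp only [Tet.stiff]
  rw [← Finset.mul_sum, ← inner_sum, Tet.sum_affineGrad_bary h, inner_zero_right, mul_zero]

/-- Integration over a finite union of tetrahedra without common interior points. -/
theorem integral_biUnion_body (S : Finset Tet)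
    (hS : ∀ t ∈ S, ∀ t' ∈ S, ∀ x ∈ interior t.body, x ∈ t'.body → t = t') {F : E3 → ℝ}
    (hF : ∀ t ∈ S, IntegrableOn F t.body) :
    ∫ x in ⋃ t ∈ S, t.body, F x = ∑ t ∈ S, ∫ x in t.body, F x := by
  have h1 : (⋃ t ∈ S, interior t.body) =ᵐ[volume] (⋃ t ∈ S, t.body) :=
    Filter.EventuallyEq.countable_bUnion S.countable_toSet fun t _ => t.interior_ae_eq_body
  rw [← setIntegral_congr_set h1, integral_biUnion_finset]
  · exact Finset.sum_congr rfl fun t _ => (t.setIntegral_interior F).symm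
  · exact fun t _ => isOpen_interior.measurableSet
  · intro t ht t' ht' hne
    refine Set.disjoint_left.2 fun x hx hx' => hne (hS t ht t' ht' x hx (interior_subset hx'))
  · exact fun t ht => (hF t ht).mono_set interior_subset

namespace MacroTriangulation

variable {M : MacroTriangulation} {ℓ : ℕ}

theorem mem_mesh {t : Tet} : t ∈ M.mesh ℓ ↔ ∃ T ∈ M.elems, t ∈ T.refine ℓ := by
  simp [mesh]

theorem mem_nodes {x : E3} : x ∈ M.nodes ℓ ↔ ∃ t ∈ M.mesh ℓ, ∃ m, t m = x := by
  simp [nodes]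

theorem mem_region {x : E3} : x ∈ M.region ↔ ∃ T ∈ M.elems, x ∈ T.body := by
  simp [region]

theorem region_eq_biUnion_mesh : M.region = ⋃ t ∈ M.mesh ℓ, t.body := by
  ext x
  simp only [mem_region, Set.mem_iUnion, mem_mesh, exists_prop]
  constructor
  · rintro ⟨T, hT, hx⟩
    obtain ⟨t, ht, hxt⟩ := (mem_body_iff_refine ℓ).1 hx
    exact ⟨t, ⟨T, hT, ht⟩, hxt⟩
  · rintro ⟨t, ⟨T, hT, ht⟩, hxt⟩
    exact ⟨T, hT, (mem_body_iff_refine ℓ).2 ⟨t, ht, hxt⟩⟩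

theorem affineIndependent_of_mem_mesh {t : Tet} (ht : t ∈ M.mesh ℓ) : AffineIndependent ℝ t := by
  obtain ⟨T, hT, ht⟩ := mem_mesh.1 ht
  exact affineIndependent_of_mem_refine (M.nondegenerate T hT) ht

theorem body_subset_region {t : Tet} (ht : t ∈ M.mesh ℓ) : t.body ⊆ M.region := by
  rw [region_eq_biUnion_mesh (ℓ := ℓ)]
  exact Set.subset_biUnion_of_mem (u := fun t : Tet => t.body) ht

/-- Distinct macro-elements share no interior point of one of them: such a point would make all
vertices of the first element vertices of the second. -/
theorem elem_eq_of_interior {S T : Tet} (hS : S ∈ M.elems) (hT : T ∈ M.elems) {x : E3}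
    (hx : x ∈ interior S.body) (hx' : x ∈ T.body) : S = T := by
  have hSi := M.nondegenerate S hS
  have hTi := M.nondegenerate T hT
  have hh : x ∈ convexHull ℝ (Set.range S ∩ Set.range T) := by
    rw [← M.conforming S hS T hT]
    exact ⟨interior_subset hx, hx'⟩
  rw [Tet.interior_body hSi] at hx
  have hsub : Set.range S ⊆ Set.range T := by
    rintro _ ⟨m, rfl⟩
    by_contra hm
    exact (hx m).ne' (bary_eq_zero_of_mem_hull hSi hh hm)
  refine M.distinct S hS T hT (Set.eq_of_subset_of_ncard_le hsub ?_ (Set.finite_range T))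
  rw [← Set.image_univ, ← Set.image_univ, Set.ncard_image_of_injective _ hSi.injective,
    Set.ncard_image_of_injective _ hTi.injective]

theorem refine_body_subset {T t : Tet} (ht : t ∈ T.refine ℓ) : t.body ⊆ T.body :=
  fun _ hx => (mem_body_iff_refine ℓ).2 ⟨t, ht, hx⟩

theorem mesh_eq_of_interior {t t' : Tet} (ht : t ∈ M.mesh ℓ) (ht' : t' ∈ M.mesh ℓ) {x : E3}
    (hx : x ∈ interior t.body) (hx' : x ∈ t'.body) : t = t' := by
  obtain ⟨T, hT, htT⟩ := mem_mesh.1 ht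
  obtain ⟨T', hT', htT'⟩ := mem_mesh.1 ht'
  obtain rfl := elem_eq_of_interior hT hT' (interior_mono (refine_body_subset htT) hx)
    (refine_body_subset htT' hx')
  exact eq_of_interior_refine (M.nondegenerate T hT) htT htT' hx hx'

theorem sum_mesh (F : Tet → ℝ) : ∑ t ∈ M.mesh ℓ, F t = ∑ T ∈ M.elems, ∑ t ∈ T.refine ℓ, F t := by
  classical
  rw [mesh, Finset.sum_biUnion]
  intro S hS T hT hne
  refine Finset.disjoint_left.2 fun t h1 h2 => hne ?_
  obtain ⟨x, hx⟩ := Tet.interior_body_nonempty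
    (affineIndependent_of_mem_refine (M.nondegenerate S hS) h1)
  exact elem_eq_of_interior hS hT (interior_mono (refine_body_subset h1) hx)
    (refine_body_subset h2 (interior_subset hx))

/-- The refinements of two macro-elements induce the same lattice on their common face. -/
theorem isLattice_of_mem_nodes {x : E3} (hx : x ∈ M.nodes ℓ) {T : Tet} (hT : T ∈ M.elems)
    (hxT : x ∈ T.body) : T.IsLattice (2 ^ ℓ) x := by
  obtain ⟨t, ht, m, rfl⟩ := mem_nodes.1 hx
  obtain ⟨S, hS, ht⟩ := mem_mesh.1 ht
  have hSi := M.nondegenerate S hS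
  have hTi := M.nondegenerate T hT
  have hl := isLattice_of_mem_refine hSi ht m
  have hh : t m ∈ convexHull ℝ (Set.range T ∩ Set.range S) := by
    rw [← M.conforming T hT S hS]
    exact ⟨hxT, refine_body_subset ht (t.vertex_mem_body m)⟩
  intro n
  by_cases hn : T n ∈ Set.range S
  · obtain ⟨n', hn'⟩ := hn
    rw [bary_eq_of_mem_hull hTi hSi hh hn'.symm]
    exact hl n'
  · exact ⟨0, by rw [bary_eq_zero_of_mem_hull hTi hh hn]; simp⟩

theorem exists_vertex_of_mem_nodes {x : E3} (hx : x ∈ M.nodes ℓ) {t : Tet} (ht : t ∈ M.mesh ℓ)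
    (hxt : x ∈ t.body) : ∃ m, t m = x := by
  obtain ⟨T, hT, htT⟩ := mem_mesh.1 ht
  exact exists_vertex_of_isLattice (M.nondegenerate T hT) htT
    (isLattice_of_mem_nodes hx hT (refine_body_subset htT hxt)) hxt

theorem vertex_mem_nodes {t : Tet} (ht : t ∈ M.mesh ℓ) (m : Fin 4) : t m ∈ M.nodes ℓ :=
  mem_nodes.2 ⟨t, ht, m, rfl⟩

/-! ### Nodal basis functions -/

open Classical in
/-- A node is a vertex of every mesh tetrahedron that contains it, so its barycentric coordinates
are `0` or `1`. -/
theorem hat_node {i j : E3} (hi : i ∈ M.nodes ℓ) (hj : j ∈ M.nodes ℓ) :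
    M.hat ℓ i j = if j = i then 1 else 0 := by
  have hval : ∀ t ∈ M.mesh ℓ, ∀ m : Fin 4, t m = i → ∀ c : Fin 4 → ℝ, (∀ n, 0 ≤ c n) →
      ∑ n, c n = 1 → ∑ n, c n • t n = j → c m = if j = i then 1 else 0 := by
    rintro t ht m rfl c hc hs rfl
    have h := affineIndependent_of_mem_mesh ht
    obtain ⟨m', hm'⟩ := exists_vertex_of_mem_nodes hj ht (Tet.mem_body.2 ⟨c, hc, hs, rfl⟩)
    rw [← Tet.bary_sum h hs m, ← hm', Tet.bary_vertex h]
    simp only [h.injective.eq_iff, eq_comm]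
  unfold hat
  by_cases hji : j = i
  · subst hji
    obtain ⟨t, ht, m, hm⟩ := mem_nodes.1 hi
    have : {r | ∃ t ∈ M.mesh ℓ, ∃ m : Fin 4, t m = j ∧ ∃ c : Fin 4 → ℝ,
        (∀ n, 0 ≤ c n) ∧ ∑ n, c n = 1 ∧ ∑ n, c n • t n = j ∧ c m = r} = {1} := by
      ext r
      simp only [Set.mem_ofPred_eq, Set.mem_singleton_iff]
      constructor
      · rintro ⟨t, ht, m, hm, c, hc, hs, hx, rfl⟩
        simpa using hval t ht m hm c hc hs hx
      · rintro rfl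
        refine ⟨t, ht, m, hm, fun n => if n = m then 1 else 0, fun n => ?_, ?_, ?_, ?_⟩
        · dsimp only
          split_ifs <;> norm_num
        · simp
        · simp [hm]
        · simp
    rw [this, if_pos rfl, csSup_singleton]
  · rw [if_neg hji]
    have : {r | ∃ t ∈ M.mesh ℓ, ∃ m : Fin 4, t m = i ∧ ∃ c : Fin 4 → ℝ,
        (∀ n, 0 ≤ c n) ∧ ∑ n, c n = 1 ∧ ∑ n, c n • t n = j ∧ c m = r} ⊆ {0} := by
      rintro r ⟨t, ht, m, hm, c, hc, hs, hx, rfl⟩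
      simpa [hji] using hval t ht m hm c hc hs hx
    rcases Set.subset_singleton_iff_eq.1 this with h | h
    · rw [h, Real.sSup_empty]
    · rw [h, csSup_singleton]

/-- `v` agrees with its nodal interpolant in the interior of every mesh tetrahedron. -/
def IsInterpolated (M : MacroTriangulation) (ℓ : ℕ) (v : E3 → ℝ) : Prop :=
  ∀ t ∈ M.mesh ℓ, Set.EqOn v (t.interp v) (interior t.body)

theorem isInterpolated_of_mem_femSpace {v : E3 → ℝ} (hv : v ∈ M.femSpace ℓ) :
    M.IsInterpolated ℓ v := by
  intro t ht
  obtain ⟨a, ha⟩ := hv.2.1 t ht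
  rw [Tet.interp_eq (affineIndependent_of_mem_mesh ht) ha]
  exact ha.mono interior_subset

/-- In the interior of a mesh tetrahedron no other mesh tetrahedron contributes to the supremum that
defines the nodal basis function. -/
theorem isInterpolated_hat {i : E3} (hi : i ∈ M.nodes ℓ) : M.IsInterpolated ℓ (M.hat ℓ i) := by
  classical
  intro t ht x hx
  have h := affineIndependent_of_mem_mesh ht
  have hr : t.interp (M.hat ℓ i) x = ∑ m, if t m = i then t.bary m x else 0 := by
    rw [Tet.interp_apply]
    refine Finset.sum_congr rfl fun m _ => ?_
    rw [hat_node hi (vertex_mem_nodes ht m)]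
    split_ifs <;> simp
  rw [hr]
  have hval : ∀ t' ∈ M.mesh ℓ, ∀ c : Fin 4 → ℝ, (∀ n, 0 ≤ c n) →
      ∑ n, c n = 1 → ∑ n, c n • t' n = x → t' = t ∧ ∀ m, c m = t.bary m x := by
    rintro t' ht' c hc hs rfl
    obtain rfl := mesh_eq_of_interior ht ht' hx (Tet.mem_body.2 ⟨c, hc, hs, rfl⟩)
    exact ⟨rfl, fun m => (Tet.bary_sum h hs m).symm⟩
  unfold hat
  by_cases hti : ∃ m, t m = i
  · obtain ⟨m, rfl⟩ := hti
    have : {r | ∃ t' ∈ M.mesh ℓ, ∃ m' : Fin 4, t' m' = t m ∧ ∃ c : Fin 4 → ℝ,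
        (∀ n, 0 ≤ c n) ∧ ∑ n, c n = 1 ∧ ∑ n, c n • t' n = x ∧ c m' = r} = {t.bary m x} := by
      ext r
      simp only [Set.mem_ofPred_eq, Set.mem_singleton_iff]
      constructor
      · rintro ⟨t', ht', m', hm', c, hc, hs, hx', rfl⟩
        obtain ⟨rfl, e⟩ := hval t' ht' c hc hs hx'
        rw [e, h.injective hm']
      · rintro rfl
        rw [Tet.interior_body h] at hx
        exact ⟨t, ht, m, rfl, fun n => t.bary n x, fun n => (hx n).le, Tet.sum_bary h x,
          Tet.sum_bary_smul h x, rfl⟩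
    rw [this, csSup_singleton]
    simp [h.injective.eq_iff]
  · have : {r | ∃ t' ∈ M.mesh ℓ, ∃ m' : Fin 4, t' m' = i ∧ ∃ c : Fin 4 → ℝ,
        (∀ n, 0 ≤ c n) ∧ ∑ n, c n = 1 ∧ ∑ n, c n • t' n = x ∧ c m' = r} = ∅ := by
      rw [Set.eq_empty_iff_forall_notMem]
      rintro r ⟨t', ht', m', hm', c, hc, hs, hx', rfl⟩
      obtain ⟨rfl, -⟩ := hval t' ht' c hc hs hx'
      exact hti ⟨m', hm'⟩
    rw [this, Real.sSup_empty]
    push Not at hti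
    simp [hti]

/-! ### The discrete forms in terms of element stiffness entries -/

theorem IsInterpolated.integral_inner {v w : E3 → ℝ} (hv : M.IsInterpolated ℓ v)
    (hw : M.IsInterpolated ℓ w) {t : Tet} (ht : t ∈ M.mesh ℓ) :
    ∫ x in t.body, inner ℝ (gradient v x) (gradient w x)
      = ∑ m, ∑ n, v (t m) * w (t n) * t.stiff m n := by
  rw [Tet.integral_inner_gradient (hv t ht) (hw t ht), Tet.volume_inner_affineGrad_interp]

theorem IsInterpolated.integrableOn_inner {v w : E3 → ℝ} (hv : M.IsInterpolated ℓ v)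
    (hw : M.IsInterpolated ℓ w) {t : Tet} (ht : t ∈ M.mesh ℓ) :
    IntegrableOn (fun x => inner ℝ (gradient v x) (gradient w x)) t.body := by
  have h1 : IntegrableOn (fun x => inner ℝ (gradient v x) (gradient w x)) (interior t.body) := by
    refine IntegrableOn.congr_fun (f := fun _ : E3 =>
      inner ℝ (affineGrad (t.interp v)) (affineGrad (t.interp w))) ?_ ?_ isOpen_interior.measurableSet
    · exact (integrableOn_const t.volume_body_ne_top).mono_set interior_subset
    · intro x hx
      simp only
      rw [gradient_eq_of_eqOn_interior (hv t ht) hx, gradient_eq_of_eqOn_interior (hw t ht) hx]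
  exact h1.congr_set_ae t.interior_ae_eq_body.symm

theorem nodalForm_eq (k : E3 → ℝ) {v w : E3 → ℝ} (hv : M.IsInterpolated ℓ v)
    (hw : M.IsInterpolated ℓ w) : M.nodalForm ℓ k v w =
      ∑ t ∈ M.mesh ℓ, (∑ m, k (t m)) / 4 * ∑ m, ∑ n, v (t m) * w (t n) * t.stiff m n :=
  Finset.sum_congr rfl fun t ht => by rw [hv.integral_inner hw ht]

open Classical in
theorem stiffness_eq {T : Tet} (hT : T ∈ M.elems) {i j : E3} (hi : i ∈ M.nodes ℓ)
    (hj : j ∈ M.nodes ℓ) : M.stiffness ℓ T i j =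
      ∑ t ∈ T.refine ℓ, ∑ m, ∑ n, (if t m = i then 1 else 0) * (if t n = j then 1 else 0) *
        t.stiff m n := by
  have hmesh : ∀ t ∈ T.refine ℓ, t ∈ M.mesh ℓ := fun t ht => mem_mesh.2 ⟨T, hT, ht⟩
  have h1 : T.body = ⋃ t ∈ T.refine ℓ, t.body := by
    ext x
    rw [mem_body_iff_refine ℓ]
    simp only [Set.mem_iUnion, exists_prop]
  have hhi := isInterpolated_hat hi
  have hhj := isInterpolated_hat hj
  rw [stiffness, h1, integral_biUnion_body]
  · refine Finset.sum_congr rfl fun t ht => ?_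
    rw [hhi.integral_inner hhj (hmesh t ht)]
    refine Finset.sum_congr rfl fun m _ => Finset.sum_congr rfl fun n _ => ?_
    rw [hat_node hi (vertex_mem_nodes (hmesh t ht) m), hat_node hj (vertex_mem_nodes (hmesh t ht) n)]
  · exact fun t ht t' ht' x hx hx' => mesh_eq_of_interior (hmesh t ht) (hmesh t' ht') hx hx'
  · exact fun t ht => hhi.integrableOn_inner hhj (hmesh t ht)

theorem stiffness_comm (T : Tet) (i j : E3) : M.stiffness ℓ T i j = M.stiffness ℓ T j i := by
  unfold stiffness
  congr 1
  ext x
  rw [real_inner_comm]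

theorem scaledForm_hat (k v : E3 → ℝ) {i : E3} (hi : i ∈ M.nodes ℓ) :
    M.scaledForm ℓ k v (M.hat ℓ i) = 1 / 2 * ∑ T ∈ M.elems, ∑ j ∈ M.nodes ℓ,
      (k i + k j) * (v j - v i) * M.stiffness ℓ T i j := by
  classical
  have h1 : ∀ T, ∑ i' ∈ M.nodes ℓ, ∑ j ∈ M.nodes ℓ,
      (k i' + k j) * (v i' - v j) * (M.hat ℓ i j - M.hat ℓ i i') * M.stiffness ℓ T i' j =
      2 * ∑ j ∈ M.nodes ℓ, (k i + k j) * (v j - v i) * M.stiffness ℓ T i j := by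
    intro T
    have e : ∀ i' ∈ M.nodes ℓ, ∀ j ∈ M.nodes ℓ,
        (k i' + k j) * (v i' - v j) * (M.hat ℓ i j - M.hat ℓ i i') * M.stiffness ℓ T i' j =
        (if j = i then (k i + k i') * (v i' - v i) * M.stiffness ℓ T i i' else 0) +
        if i' = i then (k i + k j) * (v j - v i) * M.stiffness ℓ T i j else 0 := by
      intro i' hi' j hj
      rw [hat_node hi hi', hat_node hi hj]
      by_cases h1 : j = i <;> by_cases h2 : i' = i
      · subst h1; subst h2; simp
      · subst h1
        simp only [if_true, h2, if_false]
        rw [stiffness_comm T i' j]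
        ring
      · subst h2
        simp only [if_true, h1, if_false]
        ring
      · simp [h1, h2]
    rw [Finset.sum_congr rfl fun i' hi' => Finset.sum_congr rfl fun j hj => e i' hi' j hj]
    simp only [Finset.sum_add_distrib]
    rw [Finset.sum_comm (s := M.nodes ℓ) (t := M.nodes ℓ) (f := fun i' _ =>
      if i' = i then _ else 0)]
    simp only [Finset.sum_ite_eq', hi, if_true]
    ring
  rw [scaledForm, Finset.sum_congr rfl fun T _ => h1 T, ← Finset.mul_sum]
  ring

open Classical in
/-- The two forms differ in the row of the node `i` by the contributions of the edges at `i`. -/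
theorem scaledForm_sub_nodalForm (k : E3 → ℝ) {v : E3 → ℝ} (hv : M.IsInterpolated ℓ v) {i : E3}
    (hi : i ∈ M.nodes ℓ) :
    M.scaledForm ℓ k v (M.hat ℓ i) - M.nodalForm ℓ k v (M.hat ℓ i) =
      ∑ T ∈ M.elems, ∑ t ∈ T.refine ℓ, ∑ m,
        if t m = i then ∑ n, edgeDefect k v t m n else 0 := by
  have hs : M.scaledForm ℓ k v (M.hat ℓ i) = ∑ T ∈ M.elems, ∑ t ∈ T.refine ℓ, ∑ m,
      if t m = i then ∑ n, (k (t m) + k (t n)) / 2 * (v (t n) - v (t m)) * t.stiff m n else 0 := by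
    rw [scaledForm_hat k v hi, Finset.mul_sum]
    refine Finset.sum_congr rfl fun T hT => ?_
    have h1 : ∀ j ∈ M.nodes ℓ, (k i + k j) * (v j - v i) * M.stiffness ℓ T i j =
        ∑ t ∈ T.refine ℓ, ∑ m, ∑ n, (k i + k j) * (v j - v i) *
          ((if t m = i then 1 else 0) * (if t n = j then 1 else 0) * t.stiff m n) := by
      intro j hj
      simp only [stiffness_eq hT hi hj, Finset.mul_sum]
    rw [Finset.sum_congr rfl h1, Finset.sum_comm, Finset.mul_sum]
    refine Finset.sum_congr rfl fun t ht => ?_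
    rw [Finset.sum_comm, Finset.mul_sum]
    refine Finset.sum_congr rfl fun m _ => ?_
    rw [Finset.sum_comm, Finset.mul_sum]
    by_cases hm : t m = i
    · simp only [if_pos hm]
      refine Finset.sum_congr rfl fun n _ => ?_
      have hn := vertex_mem_nodes (mem_mesh.2 ⟨T, hT, ht⟩) n
      rw [Finset.sum_eq_single_of_mem (t n) hn fun j _ hj => by rw [if_neg hj.symm]; ring]
      rw [if_pos rfl, hm]
      ring
    · simp [if_neg hm]
  have hn : M.nodalForm ℓ k v (M.hat ℓ i) = ∑ T ∈ M.elems, ∑ t ∈ T.refine ℓ, ∑ m,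
      if t m = i then ∑ n, (∑ l, k (t l)) / 4 * (v (t n) - v (t m)) * t.stiff m n else 0 := by
    rw [nodalForm_eq k hv (isInterpolated_hat hi), sum_mesh]
    refine Finset.sum_congr rfl fun T hT => Finset.sum_congr rfl fun t ht => ?_
    have htm := mem_mesh.2 ⟨T, hT, ht⟩
    rw [Finset.sum_comm, Finset.mul_sum]
    refine Finset.sum_congr rfl fun m _ => ?_
    rw [hat_node hi (vertex_mem_nodes htm m)]
    by_cases hm : t m = i
    · rw [if_pos hm, if_pos hm]
      have h0 := Tet.sum_stiff (affineIndependent_of_mem_mesh htm) m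
      have h1 : ∑ n, v (t n) * 1 * t.stiff n m = ∑ n, (v (t n) - v (t m)) * t.stiff m n := by
        simp only [sub_mul, Finset.sum_sub_distrib, ← Finset.mul_sum, h0, mul_zero, sub_zero,
          mul_one]
        exact Finset.sum_congr rfl fun n _ => by rw [Tet.stiff_comm]
      rw [h1, Finset.mul_sum]
      exact Finset.sum_congr rfl fun n _ => by ring
    · simp [hm]
  rw [hs, hn]
  simp only [← Finset.sum_sub_distrib]
  refine Finset.sum_congr rfl fun T _ => Finset.sum_congr rfl fun t _ =>
    Finset.sum_congr rfl fun m _ => ?_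
  split_ifs
  · rw [← Finset.sum_sub_distrib]
    refine Finset.sum_congr rfl fun n _ => ?_
    rw [edgeDefect]
    ring
  · ring

end MacroTriangulation

/-! ### A Lipschitz bound and integration by parts -/

open Filter Topology in
/-- A continuous function that is `C`-Lipschitz on each of finitely many closed sets that cover
the space is `C`-Lipschitz: on a segment, all right difference quotients are eventually at most
`C`, since points just behind `p` can only lie in sets that contain `p`. -/
theorem abs_sub_le_of_closed_cover {E : Type*} [NormedAddCommGroup E] [NormedSpace ℝ E]
    {v : E → ℝ} (hv : Continuous v) {S : Set (Set E)} (hfin : S.Finite)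
    (hS : ∀ K ∈ S, IsClosed K) (hcov : ∀ x, ∃ K ∈ S, x ∈ K) {C : ℝ}
    (hC : ∀ K ∈ S, ∀ x ∈ K, ∀ y ∈ K, |v y - v x| ≤ C * ‖y - x‖) (x y : E) :
    |v y - v x| ≤ C * ‖y - x‖ := by
  have key : ∀ x y : E, v y - v x ≤ C * ‖y - x‖ := by
    intro x y
    set γ : ℝ → E := fun s => x + s • (y - x) with hγ
    have hγc : Continuous γ := by fun_prop
    have hγd : ∀ s z, γ z - γ s = (z - s) • (y - x) := by
      intro s z
      simp only [hγ]
      module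
    have := image_le_of_liminf_slope_right_le_deriv_boundary (f := fun s => v (γ s) - v x)
      (a := 0) (b := 1) (B := fun s => s * (C * ‖y - x‖)) (B' := fun _ => C * ‖y - x‖)
      ((hv.comp hγc).sub continuous_const).continuousOn (by simp [hγ]) (by fun_prop)
      (fun s _ => by simpa using ((hasDerivAt_id s).mul_const (C * ‖y - x‖)).hasDerivWithinAt)
      ?_ (x := 1) (by simp)
    · simpa [hγ] using this
    intro s _ r hr
    have h1 : ∀ K ∈ S, ∀ᶠ z in 𝓝[>] s, γ z ∈ K → v (γ z) - v (γ s) ≤ (z - s) * (C * ‖y - x‖) := by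
      intro K hK
      by_cases hs : γ s ∈ K
      · filter_upwards [self_mem_nhdsWithin] with z hz hzK
        have h2 := hC K hK _ hs _ hzK
        have hz' : (0 : ℝ) < z - s := sub_pos.2 hz
        rw [hγd, norm_smul, Real.norm_eq_abs, abs_of_pos hz'] at h2
        calc v (γ z) - v (γ s) ≤ |v (γ z) - v (γ s)| := le_abs_self _
          _ ≤ _ := h2
          _ = _ := by ring
      · have h3 : ∀ᶠ z in 𝓝 s, γ z ∈ Kᶜ :=
          hγc.continuousAt.eventually ((hS K hK).isOpen_compl.mem_nhds hs)
        filter_upwards [mem_nhdsWithin_of_mem_nhds h3] with z hz hzK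
        exact absurd hzK hz
    have h2 := (eventually_all_finite hfin).2 h1
    have h3 : ∀ᶠ z in 𝓝[>] s, slope (fun s => v (γ s) - v x) s z < r := by
      filter_upwards [h2, self_mem_nhdsWithin] with z hz hsz
      obtain ⟨K, hK, hzK⟩ := hcov (γ z)
      have hz' : (0 : ℝ) < z - s := sub_pos.2 hsz
      rw [slope_def_field]
      refine lt_of_le_of_lt ?_ hr
      rw [div_le_iff₀ hz']
      have := hz K hK hzK
      linarith
    exact h3.frequently
  rw [abs_le]
  have h1 := key x y
  have h2 := key y x
  rw [norm_sub_rev] at h2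
  constructor <;> linarith

theorem lipschitzWith_affine (a : E3 →ᵃ[ℝ] ℝ) : LipschitzWith ‖affineGrad a‖₊ a := by
  refine LipschitzWith.of_dist_le_mul fun x y => ?_
  rw [Real.dist_eq, affine_sub, dist_eq_norm]
  exact abs_real_inner_le_norm _ _

/-- Integration by parts in `∫ k ∇u · ∇w` for affine `k` and `u`. -/
theorem integral_affine_mul_inner_gradient (k u : E3 →ᵃ[ℝ] ℝ) {w : E3 → ℝ} {C : NNReal}
    (hw : LipschitzWith C w) (hc : HasCompactSupport w) :
    ∫ x, k x * inner ℝ (gradient u x) (gradient w x) =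
      ∫ x, -inner ℝ (affineGrad k) (affineGrad u) * w x := by
  -- Integrate by parts along the direction `-∇u`; the line derivative of `k` is constant.
  have h1 := (lipschitzWith_affine k).integral_lineDeriv_mul_eq (μ := volume) hw hc
    (-affineGrad u)
  have h2 : ∀ x, lineDeriv ℝ k x (-affineGrad u) = -inner ℝ (affineGrad k) (affineGrad u) := by
    intro x
    rw [(hasFDerivAt_affine k x).hasLineDerivAt _ |>.lineDeriv, inner_affineGrad]
    simp
  simp only [h2, neg_neg] at h1
  rw [h1]
  refine integral_congr_ae ?_
  filter_upwards [hw.ae_differentiableAt] with x hx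
  rw [hx.lineDeriv_eq_fderiv, gradient_affine, real_inner_comm, inner_gradient_left]
  ring

/-- Affine data determine the source: `f = -∇k · ∇u` almost everywhere. -/
theorem IsWeakSolution.ae_eq {Ω : Set E3} (hΩ : IsOpen Ω) (hb : volume Ω ≠ ⊤)
    {k u : E3 →ᵃ[ℝ] ℝ} {f : E3 → ℝ} (hf : MemLp f 2 (volume.restrict Ω))
    (hu : IsWeakSolution Ω k f u) :
    ∀ᵐ x, x ∈ Ω → f x = -inner ℝ (affineGrad k) (affineGrad u) := by
  set c : ℝ := inner ℝ (affineGrad k) (affineGrad u) with hc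
  have : IsFiniteMeasure (volume.restrict Ω) := isFiniteMeasure_restrict.2 hb
  have hfi : Integrable f (volume.restrict Ω) := hf.integrable (by norm_num)
  have hg : IntegrableOn (fun x => f x + c) Ω := hfi.add (integrable_const c)
  have h := hΩ.ae_eq_zero_of_integral_contDiff_smul_eq_zero hg.locallyIntegrableOn ?_
  · filter_upwards [h] with x hx hxΩ
    have := hx hxΩ
    linarith
  intro ψ hψ hψc hψs
  have hzero : ∀ x, x ∉ Ω → ψ x = 0 := fun x hx => image_eq_zero_of_notMem_tsupport
    fun h => hx (hψs h)
  have hgzero : ∀ x, x ∉ Ω → gradient ψ x = 0 := by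
    intro x hx
    have h1 : ψ =ᶠ[nhds x] fun _ => 0 := notMem_tsupport_iff_eventuallyEq.1 fun h => hx (hψs h)
    rw [h1.gradient_eq]
    exact gradient_fun_const x 0
  obtain ⟨C, hL⟩ := hψ.lipschitzWith_of_hasCompactSupport hψc (by simp)
  have h1 := integral_affine_mul_inner_gradient k u hL hψc
  rw [← setIntegral_eq_integral_of_forall_compl_eq_zero (s := Ω) (fun x hx => by
    rw [hgzero x hx, inner_zero_right, mul_zero]), hu ψ hψ hψc hψs] at h1
  have h2 : ∫ x in Ω, -c * ψ x = ∫ x, -c * ψ x :=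
    setIntegral_eq_integral_of_forall_compl_eq_zero fun x hx => by rw [hzero x hx, mul_zero]
  rw [← setIntegral_eq_integral_of_forall_compl_eq_zero (s := Ω) (fun x hx => by
    rw [hzero x hx, zero_smul])]
  have hψL : MemLp ψ 2 (volume.restrict Ω) :=
    (hψ.continuous.memLp_of_hasCompactSupport hψc).restrict Ω
  have i1 : Integrable (fun x => f x * ψ x) (volume.restrict Ω) := hf.integrable_mul hψL
  have i2 : Integrable (fun x => -c * ψ x) (volume.restrict Ω) :=
    (hψL.integrable (by norm_num)).const_mul _
  calc ∫ x in Ω, ψ x • (f x + c) = ∫ x in Ω, (f x * ψ x - -c * ψ x) := by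
        refine integral_congr_ae (Filter.Eventually.of_forall fun x => ?_)
        simp only [smul_eq_mul]
        ring
    _ = 0 := by rw [integral_sub i1 i2, h1, h2, sub_self]

namespace MacroTriangulation

variable {M : MacroTriangulation} {ℓ : ℕ}

theorem isCompact_region : IsCompact M.region :=
  M.elems.finite_toSet.isCompact_biUnion fun T _ => T.isCompact_body

theorem closure_domain : closure M.domain = M.region := by
  refine Set.Subset.antisymm
    (closure_minimal interior_subset isCompact_region.isClosed) fun x hx => ?_
  obtain ⟨T, hT, hx⟩ := mem_region.1 hx
  have h1 := T.convex_body.closure_interior_eq_closure_of_nonempty_interior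
    (Tet.interior_body_nonempty (M.nondegenerate T hT))
  rw [T.isClosed_body.closure_eq] at h1
  rw [← h1] at hx
  exact closure_mono (interior_mono fun y hy => mem_region.2 ⟨T, hT, hy⟩) hx

theorem frontier_domain : frontier M.domain = M.region \ M.domain := by
  rw [frontier, closure_domain, domain, interior_interior]

theorem frontier_region : frontier M.region = M.region \ M.domain := by
  rw [frontier, isCompact_region.isClosed.closure_eq, domain]

theorem eq_zero_of_notMem_domain {w : E3 → ℝ} (hw : w ∈ M.femSpace₀ ℓ) {x : E3}
    (hx : x ∉ M.domain) : w x = 0 := by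
  by_cases h : x ∈ M.region
  · exact hw.2 x (by rw [frontier_domain]; exact ⟨h, hx⟩)
  · exact hw.1.2.2 x h

theorem continuous_of_mem_femSpace₀ {w : E3 → ℝ} (hw : w ∈ M.femSpace₀ ℓ) : Continuous w := by
  classical
  have h1 : w = M.region.indicator w := by
    ext x
    by_cases h : x ∈ M.region
    · rw [Set.indicator_of_mem h]
    · rw [Set.indicator_of_notMem h, hw.1.2.2 x h]
  rw [h1]
  refine continuous_indicator ?_ ?_
  · intro x hx
    rw [frontier_region] at hx
    exact eq_zero_of_notMem_domain hw hx.2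
  · rw [isCompact_region.isClosed.closure_eq]
    exact hw.1.1

theorem hasCompactSupport_of_mem_femSpace₀ {w : E3 → ℝ} (hw : w ∈ M.femSpace₀ ℓ) :
    HasCompactSupport w :=
  HasCompactSupport.intro isCompact_region fun x hx => hw.1.2.2 x hx

/-- The gradients on the mesh tetrahedra bound the Lipschitz constant of a finite element function
with zero boundary values. -/
theorem abs_sub_le_of_mem_femSpace₀ {w : E3 → ℝ} (hw : w ∈ M.femSpace₀ ℓ) {C : ℝ} (hC0 : 0 ≤ C)
    (hC : ∀ t ∈ M.mesh ℓ, ‖affineGrad (t.interp w)‖ ≤ C) (x y : E3) :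
    |w y - w x| ≤ C * ‖y - x‖ := by
  have hcont := continuous_of_mem_femSpace₀ hw
  refine abs_sub_le_of_closed_cover hcont
    (S := insert (closure M.regionᶜ) ((fun t : Tet => t.body) '' (M.mesh ℓ : Set Tet)))
    (((M.mesh ℓ).finite_toSet.image _).insert _) ?_ ?_ ?_ x y
  · rintro K (rfl | ⟨t, -, rfl⟩)
    · exact isClosed_closure
    · exact t.isClosed_body
  · intro x
    by_cases h : x ∈ M.region
    · rw [region_eq_biUnion_mesh (ℓ := ℓ)] at h
      simp only [Set.mem_iUnion, exists_prop] at h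
      obtain ⟨t, ht, hx⟩ := h
      exact ⟨_, Or.inr ⟨t, ht, rfl⟩, hx⟩
    · exact ⟨_, Or.inl rfl, subset_closure h⟩
  · rintro K (rfl | ⟨t, ht, rfl⟩) x hx y hy
    · have hz : ∀ x ∈ closure M.regionᶜ, w x = 0 := by
        have : closure M.regionᶜ ⊆ w ⁻¹' {0} :=
          closure_minimal (fun x hx => hw.1.2.2 x hx) (isClosed_singleton.preimage hcont)
        exact this
      rw [hz x hx, hz y hy, sub_zero, abs_zero]
      positivity
    · obtain ⟨a, ha⟩ := hw.1.2.1 t ht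
      have hCt := hC t ht
      rw [Tet.interp_eq (affineIndependent_of_mem_mesh ht) ha] at hCt
      rw [ha hx, ha hy, affine_sub]
      exact (abs_real_inner_le_norm _ _).trans (by gcongr)

theorem exists_lipschitzWith {w : E3 → ℝ} (hw : w ∈ M.femSpace₀ ℓ) : ∃ C, LipschitzWith C w := by
  refine ⟨∑ t ∈ M.mesh ℓ, ‖affineGrad (t.interp w)‖₊, LipschitzWith.of_dist_le_mul fun x y => ?_⟩
  rw [Real.dist_eq, dist_eq_norm]
  refine abs_sub_le_of_mem_femSpace₀ hw (NNReal.coe_nonneg _) (fun t ht => ?_) y x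
  push_cast
  exact Finset.single_le_sum (f := fun t : Tet => ‖affineGrad (t.interp w)‖)
    (fun _ _ => norm_nonneg _) ht

/-! ### The restriction of an affine function to the closed polyhedron -/

theorem indicator_mem_femSpace (u : E3 →ᵃ[ℝ] ℝ) : M.region.indicator u ∈ M.femSpace ℓ := by
  have h : Set.EqOn (M.region.indicator u) u M.region := fun x hx => Set.indicator_of_mem hx _
  refine ⟨(continuous_affine u).continuousOn.congr h, fun t ht => ⟨u, ?_⟩,
    fun x hx => Set.indicator_of_notMem hx _⟩
  exact h.mono (body_subset_region ht)

/-- The nodal form of an affine function reproduces the weak form, because the vertex mean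
integrates the coefficient exactly. -/
theorem nodalForm_indicator (k u : E3 →ᵃ[ℝ] ℝ) {w : E3 → ℝ} (hw : w ∈ M.femSpace₀ ℓ) :
    M.nodalForm ℓ k (M.region.indicator u) w =
      ∫ x, k x * inner ℝ (gradient u x) (gradient w x) := by
  have hwi := isInterpolated_of_mem_femSpace hw.1
  have hui := isInterpolated_of_mem_femSpace (indicator_mem_femSpace (M := M) (ℓ := ℓ) u)
  have hfun : ∀ t ∈ M.mesh ℓ, Set.EqOn (fun x => k x * inner ℝ (gradient u x) (gradient w x))
      (fun x => k x * inner ℝ (affineGrad u) (affineGrad (t.interp w))) (interior t.body) := by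
    intro t ht x hx
    simp only
    rw [gradient_affine, gradient_eq_of_eqOn_interior (hwi t ht) hx]
  have hint : ∀ t : Tet, IntegrableOn
      (fun x => k x * inner ℝ (affineGrad u) (affineGrad (t.interp w))) t.body := fun t =>
    t.integrableOn_of_continuous ((continuous_affine k).mul continuous_const)
  rw [← setIntegral_eq_integral_of_forall_compl_eq_zero (s := M.region),
    region_eq_biUnion_mesh (ℓ := ℓ), integral_biUnion_body]
  · refine Finset.sum_congr rfl fun t ht => ?_
    have hu : Set.EqOn (M.region.indicator u) u (interior t.body) := fun x hx =>
      Set.indicator_of_mem (body_subset_region ht (interior_subset hx)) _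
    rw [← region_eq_biUnion_mesh, Tet.integral_inner_gradient hu (hwi t ht), t.setIntegral_interior,
      setIntegral_congr_fun isOpen_interior.measurableSet (hfun t ht), ← t.setIntegral_interior,
      integral_mul_const, Tet.integral_affine (affineIndependent_of_mem_mesh ht)]
    ring
  · exact fun t ht t' ht' x hx hx' => mesh_eq_of_interior ht ht' hx hx'
  · intro t ht
    have h1 : IntegrableOn (fun x => k x * inner ℝ (gradient u x) (gradient w x))
        (interior t.body) :=
      ((hint t).mono_set interior_subset).congr_fun (hfun t ht).symm isOpen_interior.measurableSet
    exact h1.congr_set_ae t.interior_ae_eq_body.symm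
  · intro x hx
    have h1 : w =ᶠ[nhds x] fun _ => 0 := Filter.eventuallyEq_of_mem
      (isCompact_region.isClosed.isOpen_compl.mem_nhds hx) fun y hy => hw.1.2.2 y hy
    have h2 : gradient w x = 0 := by
      rw [h1.gradient_eq]
      exact gradient_fun_const x 0
    rw [h2, inner_zero_right, mul_zero]

/-- Consistency of the nodal form for affine data. -/
theorem nodalForm_eq_integral {k u : E3 →ᵃ[ℝ] ℝ} {f : E3 → ℝ}
    (hf : MemLp f 2 (volume.restrict M.domain)) (hu : IsWeakSolution M.domain k f u)
    {w : E3 → ℝ} (hw : w ∈ M.femSpace₀ ℓ) :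
    M.nodalForm ℓ k (M.region.indicator u) w = ∫ x in M.domain, f x * w x := by
  obtain ⟨C, hC⟩ := exists_lipschitzWith hw
  have hfin : volume M.domain ≠ ⊤ :=
    ((measure_mono interior_subset).trans_lt isCompact_region.measure_lt_top).ne
  have hae := IsWeakSolution.ae_eq isOpen_interior hfin hf hu
  rw [nodalForm_indicator k u hw, integral_affine_mul_inner_gradient k u hC
    (hasCompactSupport_of_mem_femSpace₀ hw),
    ← setIntegral_eq_integral_of_forall_compl_eq_zero (s := M.domain) (fun x hx => by
      rw [eq_zero_of_notMem_domain hw hx, mul_zero])]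
  refine setIntegral_congr_ae isOpen_interior.measurableSet ?_
  filter_upwards [hae] with x hx hxd
  rw [hx hxd]

/-- The nodal form is definite on the finite element functions with zero boundary values. -/
theorem eq_zero_of_nodalForm_self {k : E3 → ℝ} (hk : ∀ x ∈ M.region, 0 < k x) {v : E3 → ℝ}
    (hv : v ∈ M.femSpace₀ ℓ) (h0 : M.nodalForm ℓ k v v = 0) : v = 0 := by
  have hvi := isInterpolated_of_mem_femSpace hv.1
  have hkt : ∀ t ∈ M.mesh ℓ, 0 < (∑ m, k (t m)) / 4 := by
    intro t ht
    have : 0 < ∑ m, k (t m) := Finset.sum_pos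
      (fun m _ => hk _ (body_subset_region ht (t.vertex_mem_body m))) Finset.univ_nonempty
    positivity
  have h1 : ∀ t ∈ M.mesh ℓ, ∫ x in t.body, inner ℝ (gradient v x) (gradient v x) =
      volume.real t.body * ‖affineGrad (t.interp v)‖ ^ 2 := fun t ht => by
    rw [Tet.integral_inner_gradient (hvi t ht) (hvi t ht), real_inner_self_eq_norm_sq]
  have hgrad : ∀ t ∈ M.mesh ℓ, ‖affineGrad (t.interp v)‖ ≤ 0 := by
    intro t ht
    rw [nodalForm, Finset.sum_eq_zero_iff_of_nonneg] at h0
    · have h2 := h0 t ht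
      rw [h1 t ht] at h2
      have hvol := Tet.volume_body_pos (affineIndependent_of_mem_mesh ht)
      simpa [(hkt t ht).ne', hvol.ne'] using h2
    · intro t ht
      rw [h1 t ht]
      have := hkt t ht
      positivity
  have hne : M.region ≠ Set.univ := fun h => noncompact_univ E3 (h ▸ isCompact_region)
  obtain ⟨y, hy⟩ := (Set.ne_univ_iff_exists_notMem _).1 hne
  ext x
  have h2 := abs_sub_le_of_mem_femSpace₀ hv le_rfl hgrad y x
  rw [hv.1.2.2 y hy, zero_mul, sub_zero] at h2
  simpa using h2

/-! ### Comparison of the forms and uniqueness -/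

open Classical in
/-- A node that belongs to no vertex or edge primitive has at most one vanishing barycentric
coordinate in each macro-element that contains it. -/
theorem card_filter_bary_ne_zero {i : E3} (hi : i ∈ M.nodes ℓ) (hV : i ∉ M.vertexNodes ℓ)
    (hE : i ∉ M.edgeNodes ℓ) {T : Tet} (hT : T ∈ M.elems) (hiT : i ∈ T.body) :
    i ∈ M.primitiveNodes ℓ (Finset.univ.filter fun m => T.bary m i ≠ 0).card ∧
    3 ≤ (Finset.univ.filter fun m => T.bary m i ≠ 0).card := by
  have h := M.nondegenerate T hT
  have hmem : i ∈ M.primitiveNodes ℓ (Finset.univ.filter fun m => T.bary m i ≠ 0).card := by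
    refine ⟨hi, T, hT, _, rfl, fun m => T.bary m i, fun m hm => ?_, fun m hm => ?_,
      Tet.sum_bary h i, Tet.sum_bary_smul h i⟩
    · rw [Tet.body_eq h] at hiT
      exact lt_of_le_of_ne (hiT m) (Finset.mem_filter.1 hm).2.symm
    · simpa using hm
  refine ⟨hmem, ?_⟩
  have h0 : (Finset.univ.filter fun m => T.bary m i ≠ 0).card ≠ 0 := by
    intro h0
    rw [Finset.card_eq_zero, Finset.filter_eq_empty_iff] at h0
    have h1 := Tet.sum_bary h i
    rw [Finset.sum_eq_zero fun m hm => not_not.1 (h0 hm)] at h1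
    exact zero_ne_one h1
  have h1 : (Finset.univ.filter fun m => T.bary m i ≠ 0).card ≠ 1 := fun h1 => hV (by
    rw [vertexNodes, ← h1]
    exact hmem)
  have h2 : (Finset.univ.filter fun m => T.bary m i ≠ 0).card ≠ 2 := fun h2 => hE (by
    rw [edgeNodes, ← h2]
    exact hmem)
  omega

open Classical in
theorem bary_pos_of_card_eq_four {i : E3} {T : Tet} (h : AffineIndependent ℝ T)
    (hiT : i ∈ T.body) (hc : (Finset.univ.filter fun m => T.bary m i ≠ 0).card = 4) (m : Fin 4) :
    0 < T.bary m i := by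
  rw [Tet.body_eq h] at hiT
  have h1 : (Finset.univ.filter fun m => T.bary m i ≠ 0) = Finset.univ := by
    rw [← Finset.card_eq_iff_eq_univ, hc, Fintype.card_fin]
  have h2 := Finset.mem_univ m
  rw [← h1] at h2
  exact lt_of_le_of_ne (hiT m) (Finset.mem_filter.1 h2).2.symm

open Classical in
theorem exists_bary_eq_zero_of_card_eq_three {i : E3} {T : Tet} (h : AffineIndependent ℝ T)
    (hiT : i ∈ T.body) (hc : (Finset.univ.filter fun m => T.bary m i ≠ 0).card = 3) :
    ∃ m, T.bary m i = 0 ∧ ∀ n, n ≠ m → 0 < T.bary n i := by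
  rw [Tet.body_eq h] at hiT
  have h1 : (Finset.univ.filter fun m => T.bary m i ≠ 0)ᶜ.card = 1 := by
    rw [Finset.card_compl, hc, Fintype.card_fin]
  obtain ⟨m, hm⟩ := Finset.card_eq_one.1 h1
  have h2 : ∀ n, T.bary n i = 0 ↔ n = m := by
    intro n
    have := congrArg (n ∈ ·) hm
    simpa using this
  exact ⟨m, (h2 m).2 rfl, fun n hn => lt_of_le_of_ne (hiT n) fun e => hn ((h2 n).1 e.symm)⟩

/-- Away from the vertex, edge and face primitives, the rows of the two forms agree for all finite
element functions. -/
theorem scaledForm_hat_eq_of_interior (k : E3 →ᵃ[ℝ] ℝ) {v : E3 → ℝ} (hv : M.IsInterpolated ℓ v)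
    {i : E3} (hi : i ∈ M.nodes ℓ) (hV : i ∉ M.vertexNodes ℓ) (hE : i ∉ M.edgeNodes ℓ)
    (hF : i ∉ M.faceNodes ℓ) :
    M.scaledForm ℓ k v (M.hat ℓ i) = M.nodalForm ℓ k v (M.hat ℓ i) := by
  classical
  rw [← sub_eq_zero, scaledForm_sub_nodalForm k hv hi]
  refine Finset.sum_eq_zero fun T hT => ?_
  by_cases hiT : i ∈ T.body
  · have h := M.nondegenerate T hT
    obtain ⟨hmem, hcard⟩ := card_filter_bary_ne_zero hi hV hE hT hiT
    have h3 : (Finset.univ.filter fun m => T.bary m i ≠ 0).card ≠ 3 := fun h3 => hF (by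
      rw [faceNodes, ← h3]
      exact hmem)
    have h4 := Finset.card_le_univ (Finset.univ.filter fun m => T.bary m i ≠ 0)
    rw [Fintype.card_fin] at h4
    exact sum_edgeDefect_interior h (isLattice_of_mem_nodes hi hT hiT)
      (bary_pos_of_card_eq_four h hiT (by omega)) k v
  · refine Finset.sum_eq_zero fun t ht => Finset.sum_eq_zero fun m _ => if_neg ?_
    rintro rfl
    exact hiT (refine_body_subset ht (t.vertex_mem_body m))

/-- Away from the vertex and edge primitives, the rows of the two forms agree for affine
functions. -/
theorem scaledForm_hat_eq_of_affine (k u : E3 →ᵃ[ℝ] ℝ) {i : E3} (hi : i ∈ M.nodes ℓ)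
    (hV : i ∉ M.vertexNodes ℓ) (hE : i ∉ M.edgeNodes ℓ) :
    M.scaledForm ℓ k (M.region.indicator u) (M.hat ℓ i) =
      M.nodalForm ℓ k (M.region.indicator u) (M.hat ℓ i) := by
  classical
  rw [← sub_eq_zero, scaledForm_sub_nodalForm k
    (isInterpolated_of_mem_femSpace (indicator_mem_femSpace u)) hi]
  refine Finset.sum_eq_zero fun T hT => ?_
  have hcongr : ∀ t ∈ T.refine ℓ, ∀ m n,
      edgeDefect k (M.region.indicator u) t m n = edgeDefect k u t m n := by
    intro t ht m n
    have hr : ∀ m, M.region.indicator u (t m) = u (t m) := fun m =>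
      Set.indicator_of_mem (body_subset_region (mem_mesh.2 ⟨T, hT, ht⟩) (t.vertex_mem_body m)) _
    rw [edgeDefect, edgeDefect, hr, hr]
  rw [Finset.sum_congr rfl fun t ht => Finset.sum_congr rfl fun m _ => by
    rw [Finset.sum_congr rfl fun n _ => hcongr t ht m n]]
  by_cases hiT : i ∈ T.body
  · have h := M.nondegenerate T hT
    obtain ⟨hmem, hcard⟩ := card_filter_bary_ne_zero hi hV hE hT hiT
    have h4 := Finset.card_le_univ (Finset.univ.filter fun m => T.bary m i ≠ 0)
    rw [Fintype.card_fin] at h4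
    have hl := isLattice_of_mem_nodes hi hT hiT
    by_cases h3 : (Finset.univ.filter fun m => T.bary m i ≠ 0).card = 3
    · obtain ⟨m, hm, hpos⟩ := exists_bary_eq_zero_of_card_eq_three h hiT h3
      exact sum_edgeDefect_face h hl hm hpos k u
    · exact sum_edgeDefect_interior h hl (bary_pos_of_card_eq_four h hiT (by omega)) k u
  · refine Finset.sum_eq_zero fun t ht => Finset.sum_eq_zero fun m _ => if_neg ?_
    rintro rfl
    exact hiT (refine_body_subset ht (t.vertex_mem_body m))

theorem nodalForm_eq_sum_hat (k : E3 → ℝ) {v w : E3 → ℝ} (hv : M.IsInterpolated ℓ v)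
    (hw : M.IsInterpolated ℓ w) :
    M.nodalForm ℓ k v w = ∑ i ∈ M.nodes ℓ, w i * M.nodalForm ℓ k v (M.hat ℓ i) := by
  classical
  have h1 : ∀ i ∈ M.nodes ℓ, w i * M.nodalForm ℓ k v (M.hat ℓ i) = ∑ t ∈ M.mesh ℓ,
      (∑ m, k (t m)) / 4 * ∑ m, ∑ n, v (t m) * (if t n = i then w i else 0) * t.stiff m n := by
    intro i hi
    rw [nodalForm_eq k hv (isInterpolated_hat hi), Finset.mul_sum]
    refine Finset.sum_congr rfl fun t ht => ?_
    simp only [Finset.mul_sum]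
    refine Finset.sum_congr rfl fun m _ => Finset.sum_congr rfl fun n _ => ?_
    rw [hat_node hi (vertex_mem_nodes ht n)]
    split_ifs <;> ring
  rw [Finset.sum_congr rfl h1, Finset.sum_comm, nodalForm_eq k hv hw]
  refine Finset.sum_congr rfl fun t ht => ?_
  rw [← Finset.mul_sum]
  congr 1
  symm
  rw [Finset.sum_comm]
  refine Finset.sum_congr rfl fun m _ => ?_
  rw [Finset.sum_comm]
  refine Finset.sum_congr rfl fun n _ => ?_
  rw [← Finset.sum_mul, ← Finset.mul_sum, Finset.sum_ite_eq, if_pos (vertex_mem_nodes ht n)]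

theorem mixedForm_eq_nodalForm {k v w : E3 → ℝ} {I : Set E3} (hv : M.IsInterpolated ℓ v)
    (hw : M.IsInterpolated ℓ w) (h : ∀ i ∈ M.nodes ℓ, i ∉ I →
      M.scaledForm ℓ k v (M.hat ℓ i) = M.nodalForm ℓ k v (M.hat ℓ i)) :
    M.mixedForm ℓ I k v w = M.nodalForm ℓ k v w := by
  classical
  rw [nodalForm_eq_sum_hat k hv hw]
  refine Finset.sum_congr rfl fun i hi => ?_
  by_cases hI : i ∈ I
  · rw [if_pos hI]
  · rw [if_neg hI, h i hi hI]

theorem scaledForm_sub_left (k v v' w : E3 → ℝ) :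
    M.scaledForm ℓ k (v - v') w = M.scaledForm ℓ k v w - M.scaledForm ℓ k v' w := by
  simp only [scaledForm, ← mul_sub, ← Finset.sum_sub_distrib, Pi.sub_apply]
  congr 1
  refine Finset.sum_congr rfl fun T _ => Finset.sum_congr rfl fun i _ =>
    Finset.sum_congr rfl fun j _ => by ring

theorem nodalForm_sub_left (k : E3 → ℝ) {v v' w : E3 → ℝ} (hv : v ∈ M.femSpace ℓ)
    (hv' : v' ∈ M.femSpace ℓ) (hw : M.IsInterpolated ℓ w) :
    M.nodalForm ℓ k (v - v') w = M.nodalForm ℓ k v w - M.nodalForm ℓ k v' w := by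
  rw [nodalForm_eq k (isInterpolated_of_mem_femSpace (sub_mem hv hv')) hw,
    nodalForm_eq k (isInterpolated_of_mem_femSpace hv) hw,
    nodalForm_eq k (isInterpolated_of_mem_femSpace hv') hw, ← Finset.sum_sub_distrib]
  refine Finset.sum_congr rfl fun t _ => ?_
  simp only [← mul_sub, ← Finset.sum_sub_distrib, Pi.sub_apply]
  congr 1
  refine Finset.sum_congr rfl fun m _ => Finset.sum_congr rfl fun n _ => by ring

theorem mixedForm_sub_left (k : E3 → ℝ) (I : Set E3) {v v' : E3 → ℝ} (w : E3 → ℝ)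
    (hv : v ∈ M.femSpace ℓ) (hv' : v' ∈ M.femSpace ℓ) :
    M.mixedForm ℓ I k (v - v') w = M.mixedForm ℓ I k v w - M.mixedForm ℓ I k v' w := by
  simp only [mixedForm, ← Finset.sum_sub_distrib]
  refine Finset.sum_congr rfl fun i hi => ?_
  split_ifs
  · rw [nodalForm_sub_left k hv hv' (isInterpolated_hat hi)]
    ring
  · rw [scaledForm_sub_left]
    ring

/-- If the nodal form is used on all vertex, edge and face primitives, then the mixed form is the
nodal form, hence non-degenerate. -/
theorem isNondegenerate_of_faces {k : E3 →ᵃ[ℝ] ℝ} (hk : ∀ x ∈ M.region, 0 < k x) :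
    M.IsNondegenerate ℓ (M.vertexNodes ℓ ∪ M.edgeNodes ℓ ∪ M.faceNodes ℓ) k := by
  intro v hv h
  have hvi := isInterpolated_of_mem_femSpace hv.1
  refine eq_zero_of_nodalForm_self hk hv ?_
  rw [← h v hv]
  refine (mixedForm_eq_nodalForm hvi hvi fun i hi hI => ?_).symm
  simp only [Set.mem_union, not_or] at hI
  exact scaledForm_hat_eq_of_interior k hvi hi hI.1.1 hI.1.2 hI.2

theorem isDiscreteSolution_indicator {k u : E3 →ᵃ[ℝ] ℝ} {f : E3 → ℝ}
    (hf : MemLp f 2 (volume.restrict M.domain)) (hu : IsWeakSolution M.domain k f u) {I : Set E3}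
    (hI : M.vertexNodes ℓ ∪ M.edgeNodes ℓ ⊆ I) :
    M.IsDiscreteSolution ℓ I k f u (M.region.indicator u) := by
  refine ⟨indicator_mem_femSpace u, fun x hx => ?_, fun w hw => ?_⟩
  · rw [frontier_domain] at hx
    exact Set.indicator_of_mem hx.1 _
  · rw [← nodalForm_eq_integral hf hu hw]
    refine mixedForm_eq_nodalForm (isInterpolated_of_mem_femSpace (indicator_mem_femSpace u))
      (isInterpolated_of_mem_femSpace hw.1) fun i hi hiI => ?_
    exact scaledForm_hat_eq_of_affine k u hi (fun h => hiI (hI (Or.inl h)))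
      fun h => hiI (hI (Or.inr h))

theorem IsDiscreteSolution.eq_of_isNondegenerate {k f g v v' : E3 → ℝ} {I : Set E3}
    (h : M.IsNondegenerate ℓ I k) (hv : M.IsDiscreteSolution ℓ I k f g v)
    (hv' : M.IsDiscreteSolution ℓ I k f g v') : v = v' := by
  refine sub_eq_zero.1 (h (v - v') ⟨sub_mem hv.1 hv'.1, fun x hx => ?_⟩ fun w hw => ?_)
  · rw [Pi.sub_apply, hv.2.1 x hx, hv'.2.1 x hx, sub_self]
  · rw [mixedForm_sub_left k I w hv.1 hv'.1, hv.2.2 w hw, hv'.2.2 w hw, sub_self]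

end MacroTriangulation

end StencilScaling

end

theorem lemma5p1 (M : StencilScaling.MacroTriangulation) (ℓ : ℕ)
    (k u : StencilScaling.E3 →ᵃ[ℝ] ℝ) (k₀ : ℝ) (hk₀ : 0 < k₀) (hk : ∀ x ∈ M.domain, k₀ ≤ k x)
    (f : StencilScaling.E3 → ℝ) (hf : MemLp f 2 (volume.restrict M.domain))
    (hu : StencilScaling.IsWeakSolution M.domain k f u)
    (I : Set StencilScaling.E3)
    (hI : I = M.vertexNodes ℓ ∪ M.edgeNodes ℓ ∪ M.faceNodes ℓ ∨
      I = M.vertexNodes ℓ ∪ M.edgeNodes ℓ) :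
    (∃ uh, M.IsDiscreteSolution ℓ I k f u uh ∧ Set.EqOn uh u (closure M.domain)) ∧
    (I = M.vertexNodes ℓ ∪ M.edgeNodes ℓ ∪ M.faceNodes ℓ ∨ M.IsNondegenerate ℓ I k →
      ∀ uh, M.IsDiscreteSolution ℓ I k f u uh → Set.EqOn uh u (closure M.domain)) := by
  have hsub : M.vertexNodes ℓ ∪ M.edgeNodes ℓ ⊆ I := by
    rcases hI with rfl | rfl
    · exact Set.subset_union_left
    · exact subset_rfl
  have hsol := StencilScaling.MacroTriangulation.isDiscreteSolution_indicator hf hu hsub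
  have heq : Set.EqOn (M.region.indicator u) u (closure M.domain) := by
    rw [StencilScaling.MacroTriangulation.closure_domain]
    exact fun x hx => Set.indicator_of_mem hx _
  refine ⟨⟨_, hsol, heq⟩, fun h uh huh => ?_⟩
  have hkpos : ∀ x ∈ M.region, 0 < k x := by
    intro x hx
    rw [← StencilScaling.MacroTriangulation.closure_domain] at hx
    have hcl : closure M.domain ⊆ {x | k₀ ≤ k x} :=
      closure_minimal hk (isClosed_le continuous_const (StencilScaling.continuous_affine k))
    exact hk₀.trans_le (hcl hx)
  have hnd : M.IsNondegenerate ℓ I k := by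
    rcases h with rfl | h
    · exact StencilScaling.MacroTriangulation.isNondegenerate_of_faces hkpos
    · exact h
  rwa [StencilScaling.MacroTriangulation.IsDiscreteSolution.eq_of_isNondegenerate hnd huh hsol]
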